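/- **Setting.** Let $\Gamma$ be the vertex set of a connected graph with graph distance $d$. Let $\mathcal H_x$ ($x\in\Gamma$) be finite-dimensional Hilbert spaces. For finite $X\subset\Gamma$ let $\mathcal A_X$ be the algebra of operators on $\mathcal H_X=\bigotimes_{x\in X}\mathcal H_x$ with the operator norm. For $X\subset X'$ identify $A\in\mathcal A_X$ with $A\otimes 1\in\mathcal A_{X'}$; elements of $\mathcal A_X$ are said to be supported in $X$. A *volume* is a finite connected set $\Lambda\subset\Gamma$. For $K\subset\Lambda$ and $l>0$ put $K_l=\{x\in\Lambda : d(k,x)\le l\text{ for some }k\in K\}$. Let $F_0:[0,\infty)\to(0,\infty)$ be non-increasing and, for $\mu\ge0$, put $F_\mu(r)=e^{-\mu r}F_0(r)$. Let $$\|F_\mu\|=\sup_{x}\sum_y F_\mu(d(x,y)),\qquad C_\mu=\sup_{x,y}\sum_z \frac{F_\mu(d(x,z))F_\mu(d(z,y))}{F_\mu(d(x,y))},$$ and assume $\|F_0\|<\infty$ and $C_0<\infty$. Fix $\mu>0$. Let $\Phi=\{\Phi(X)\}$, indexed by the finite $X\subset\Gamma$, be a family of self-adjoint operators $\Phi(X)\in\mathcal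 A_X$ with $\|\Phi\|_\mu=\sup_{x,y}\sum_{X\ni x,y}\|\Phi(X)\|/F_\mu(d(x,y))<\infty$. Let $\|\Phi\|'_\mu$ be the same supremum with the sums restricted to $|X|>1$, and put $$H^\Phi_\Lambda=\sum_{X\subset\Lambda}\Phi(X),\qquad v=\frac{2\|\Phi\|'_\mu C_\mu}{\mu}.$$ Let $K\subset\Gamma$ be finite. For $k\in K$ let $W_k:[0,1]\to\mathcal A_{\{k\}}$ be a smooth path of self-adjoint operators with $W_k(0)=0$. Put $W=\sum_{k\in K}W_k$, assume $\|W'(s)\|\le C_W$ for all $s\in[0,1]$, and for volumes $\Lambda\supset K$ put $H(s)=H^\Phi_\Lambda+W(s)$. The path $H(s)$ *maintains a $g$-gapped $D$-dimensional sector of width at most $L$* (where $g>0$) if for every $s\in[0,1]$ its spectrum is a union $\sigma_{\rm in}(s)\cup\sigma_{\rm out}(s)$ such that the following hold. The distance between $\sigma_{\rm in}(s)$ and $\sigma_{\rm out}(s)$ is at least $g$. The set $\sigma_{\rm in}(s)$ lies in an interval $[a(s),b(s)]$ of length at most $L$ that does not intersect $\sigma_{\rm out}(s)$ and whose endpoints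 depend continuously on $s$. The eigenspaces for the eigenvalues in $\sigma_{\rm in}(s)$ together span a space of dimension $D$. For each $s$ let $\psi_1(s),\dots,\psi_D(s)$ be orthonormal eigenvectors of $H(s)$ with eigenvalues in $\sigma_{\rm in}(s)$. **Theorem 3.2.** Let $\xi=\frac1\mu+\frac{2v}{g}$. For every $\mu'<1/\xi$ there is a constant $C\ge0$, depending only on $\mu'$, $\mu$, $\|F_0\|$, $C_\mu$, $v$, $D$, $|K|$, $g$, $C_W$ and $L$ (in particular not on the volume $\Lambda$), with the following property. For every volume $\Lambda\supset K$ on which $H(s)$ maintains a $g$-gapped $D$-dimensional sector of width at most $L$, every choice of the eigenvectors $\psi_i(s)$ as above, every $l>0$ and every $i=1,\dots,D$, there are operators $L^l_{ij}$, $j=1,\dots,D$, supported in $K_l$, with $$\|L^l_{ij}\|\le C\quad (j=1,\dots,D)\qquad\text{and}\qquad \Bigl\|\psi_i(1)-\sum_{j=1}^D L^l_{ij}\,\psi_j(0)\Bigr\|\le C\,e^{-\mu' l}.$$ -/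

import Mathlib

open Set
open scoped ENNReal ContDiff

universe u

noncomputable section

namespace QuantumSpin

variable {Γ : Type u} [DecidableEq Γ]

/-- Spin configurations on the finite set `X`; they label the product basis of the tensor product
of the site spaces `ℂ ^ (n x)`, `x ∈ X`. -/
abbrev Conf (n : Γ → ℕ) (X : Finset Γ) : Type u := (x : X) → Fin (n x)

/-- The Hilbert space `⨂_{x ∈ X} ℂ ^ (n x)`, realised as the space of square-summable functions
on its product basis. -/
abbrev Hilb (n : Γ → ℕ) (X : Finset Γ) : Type u := EuclideanSpace ℂ (Conf n X)

/-- The algebra of observables with support in `X`: all operators on `Hilb n X`, with the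
operator norm. -/
abbrev Op (n : Γ → ℕ) (X : Finset Γ) : Type u := Hilb n X →L[ℂ] Hilb n X

/-- The matrix of an observable in the product basis. -/
def toMat {n : Γ → ℕ} {X : Finset Γ} (A : Op n X) : Matrix (Conf n X) (Conf n X) ℂ :=
  (Matrix.toEuclideanCLM (n := Conf n X) (𝕜 := ℂ)).symm A

/-- The identification of `A` in `Op n X` with `A ⊗ 1` in `Op n Y`, for `X ⊆ Y`. -/
def embed {n : Γ → ℕ} {X Y : Finset Γ} (h : X ⊆ Y) (A : Op n X) : Op n Y :=
  Matrix.toEuclideanCLM (n := Conf n Y) (𝕜 := ℂ) <| Matrix.of fun σ τ =>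
    if ∀ y : Y, (y : Γ) ∉ X → σ y = τ y then
      toMat A (fun x => σ ⟨x, h x.2⟩) (fun x => τ ⟨x, h x.2⟩)
    else 0

/-- The operator `A` on the volume `Y` has support in `X ⊆ Y`. -/
def SupportedIn {n : Γ → ℕ} {X Y : Finset Γ} (h : X ⊆ Y) (A : Op n Y) : Prop :=
  ∃ B : Op n X, embed h B = A

/-- An interaction: a family of self-adjoint local operators indexed by the finite sets. -/
structure Interaction (n : Γ → ℕ) where
  term : (X : Finset Γ) → Op n X
  selfAdjoint : ∀ X, IsSelfAdjoint (term X)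

/-- The Hamiltonian of the volume `Λ` with open boundary conditions, the sum of the terms
`Φ(X)` over all `X ⊆ Λ`. -/
def hamiltonian {n : Γ → ℕ} (Φ : Interaction n) (Λ : Finset Γ) : Op n Λ :=
  ∑ X ∈ Λ.powerset.attach, embed (Finset.mem_powerset.1 X.2) (Φ.term X)

/-- The sum over `k ∈ K` of the single-site operators `W k s`, as an operator on `Λ ⊇ K`. -/
def perturbation {n : Γ → ℕ} {K Λ : Finset Γ} (h : K ⊆ Λ) (W : (k : Γ) → ℝ → Op n {k}) (s : ℝ) :
    Op n Λ :=
  ∑ k ∈ K.attach, embed (Finset.singleton_subset_iff.2 (h k.2)) (W k s)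

/-- The path of Hamiltonians `H(s) = H^Φ + W(s)` on `Λ`. -/
def hamiltonianPath {n : Γ → ℕ} (Φ : Interaction n) {K Λ : Finset Γ} (h : K ⊆ Λ)
    (W : (k : Γ) → ℝ → Op n {k}) (s : ℝ) : Op n Λ :=
  hamiltonian Φ Λ + perturbation h W s

/-- The paths `W k`, `k ∈ K`, are smooth paths of self-adjoint operators on `[0, 1]` that start
at zero. -/
structure IsPerturbationPath {n : Γ → ℕ} (K : Finset Γ) (W : (k : Γ) → ℝ → Op n {k}) :
    Prop where
  smooth : ∀ k ∈ K, ContDiffOn ℝ ∞ (W k) (Icc 0 1)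
  selfAdjoint : ∀ k ∈ K, ∀ s ∈ Icc (0 : ℝ) 1, IsSelfAdjoint (W k s)
  zero : ∀ k ∈ K, W k 0 = 0

section Geometry

variable (G : SimpleGraph Γ)

/-- The `l`-fattening of `K` inside `Λ`: the sites of `Λ` at graph distance at most `l`
from `K`. -/
def fattening (Λ K : Finset Γ) (l : ℝ) : Finset Γ := by
  classical exact Λ.filter fun x => ∃ k ∈ K, (G.dist k x : ℝ) ≤ l

set_option linter.unusedSectionVars false in
lemma fattening_subset (Λ K : Finset Γ) (l : ℝ) : fattening G Λ K l ⊆ Λ := by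
  classical exact Finset.filter_subset _ _

/-- A volume: a finite connected set of vertices. -/
def IsVolume (Λ : Finset Γ) : Prop := (G.induce (Λ : Set Γ)).Connected

/-- The function `F_μ(r) = e^{-μ r} F(r)`. -/
def weight (F : ℝ → ℝ) (μ : ℝ) (r : ℝ) : ℝ := Real.exp (-μ * r) * F r

/-- `sup_x ∑_y F(d(x,y))`. -/
def sumNorm (F : ℝ → ℝ) : ℝ≥0∞ := ⨆ x : Γ, ∑' y : Γ, ENNReal.ofReal (F (G.dist x y))

/-- `sup_{x,y} ∑_z F(d(x,z)) F(d(z,y)) / F(d(x,y))`. -/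
def convConst (F : ℝ → ℝ) : ℝ≥0∞ :=
  ⨆ (x : Γ) (y : Γ), ∑' z : Γ,
    ENNReal.ofReal (F (G.dist x z) * F (G.dist z y) / F (G.dist x y))

/-- `F` is a non-increasing function from `[0, ∞)` to `(0, ∞)` that is uniformly summable and
has the convolution property (values of `F` at negative arguments are irrelevant). -/
structure IsDecayFunction (F : ℝ → ℝ) : Prop where
  pos : ∀ r, 0 ≤ r → 0 < F r
  antitone : AntitoneOn F (Ici 0)
  summable : sumNorm G F < ⊤
  convolution : convConst G F < ⊤

/-- `‖Φ‖ = sup_{x,y} ∑_{X ∋ x,y} ‖Φ(X)‖ / F(d(x,y))`. -/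
def Interaction.norm {n : Γ → ℕ} (F : ℝ → ℝ) (Φ : Interaction n) : ℝ≥0∞ :=
  ⨆ (x : Γ) (y : Γ), ∑' X : {X : Finset Γ // x ∈ X ∧ y ∈ X},
    ENNReal.ofReal (‖Φ.term X.1‖ / F (G.dist x y))

/-- The same supremum without the single-site terms. -/
def Interaction.norm' {n : Γ → ℕ} (F : ℝ → ℝ) (Φ : Interaction n) : ℝ≥0∞ :=
  ⨆ (x : Γ) (y : Γ), ∑' X : {X : Finset Γ // (x ∈ X ∧ y ∈ X) ∧ 1 < X.card},
    ENNReal.ofReal (‖Φ.term X.1‖ / F (G.dist x y))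

/-- The Lieb--Robinson velocity `2 ‖Φ‖'_μ C_μ / μ`. -/
def velocity {n : Γ → ℕ} (F : ℝ → ℝ) (μ : ℝ) (Φ : Interaction n) : ℝ :=
  2 * (Φ.norm' G (weight F μ)).toReal * (convConst G (weight F μ)).toReal / μ

end Geometry

/-- The length scale `ξ = 1/μ + 2 v/g`. -/
def xi (μ v g : ℝ) : ℝ := 1 / μ + 2 * (v / g)

/-- The vectors `ψ i` form an orthonormal set of eigenvectors of `H`, with eigenvalues
in `S`. -/
def IsEigenbasisIn {n : Γ → ℕ} {Λ : Finset Γ} {D : ℕ} (H : Op n Λ) (S : Set ℝ)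
    (ψ : Fin D → Hilb n Λ) : Prop :=
  Orthonormal ℂ ψ ∧ ∃ ev : Fin D → ℝ, ∀ i, ev i ∈ S ∧ H (ψ i) = (ev i : ℂ) • ψ i

/-- The span of all eigenvectors of `H` with eigenvalue in `S`. -/
def sectorSpace {n : Γ → ℕ} {Λ : Finset Γ} (H : Op n Λ) (S : Set ℝ) : Submodule ℂ (Hilb n Λ) :=
  ⨆ r ∈ S, Module.End.eigenspace (H : Hilb n Λ →ₗ[ℂ] Hilb n Λ) (r : ℂ)

/-- The spectrum of `H(s)`, `s ∈ [0, 1]`, is the union of `σin s` and `σout s`, at distance at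
least `g` from each other. The part `σin s` lies in an interval `[a s, b s]` of length at most `L`
that does not meet `σout s` and moves continuously with `s`, and its eigenspaces together have
dimension `D`. -/
structure IsGappedSector {n : Γ → ℕ} {Λ : Finset Γ} (H : ℝ → Op n Λ) (σin σout : ℝ → Set ℝ)
    (g L : ℝ) (D : ℕ) : Prop where
  spectrum_eq : ∀ s ∈ Icc (0 : ℝ) 1, spectrum ℝ (H s) = σin s ∪ σout s
  interval : ∃ a b : ℝ → ℝ, ContinuousOn a (Icc 0 1) ∧ ContinuousOn b (Icc 0 1) ∧
    ∀ s ∈ Icc (0 : ℝ) 1, a s ≤ b s ∧ b s - a s ≤ L ∧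
      σin s ⊆ Icc (a s) (b s) ∧ Disjoint (Icc (a s) (b s)) (σout s)
  gap : ∀ s ∈ Icc (0 : ℝ) 1, ∀ x ∈ σin s, ∀ y ∈ σout s, g ≤ |x - y|
  dim : ∀ s ∈ Icc (0 : ℝ) 1, Module.finrank ℂ (sectorSpace (H s) (σin s)) = D

end QuantumSpin

end

/-! The proof is a discretised quasi-adiabatic flow. Cut [0,1] into m equal steps, write H, H' for
the Hamiltonians at the two ends of a step and V = H' - H, an operator in K of norm at most C_W/m.
If x is an eigenvector of H' in the sector and e one of H outside it, with eigenvalues differing by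
ν, then ⟨e, Vx⟩ = -ν⟨e, x⟩ exactly. A Gaussian time average of e^{irH} V e^{-irH'}, cut off at time
T (`mixedGenerator`), reproduces multiplication by -1/ν for |ν| ≥ g' up to an error of order
e^{-g'T/2}. So 1 - Y sends the new sector almost into the old one, and 1 + Y leads back, because (1
+ Y)(1 - Y) = 1 - Y² and Y = O(1/m).

The Y actually used is the average of the evolution of V under the Hamiltonian of K_l alone. It is
supported in K_l and skew-adjoint, so 1 + Y is isometric to second order. Replacing H' by H on the
right costs O(T²‖V‖²). Replacing the dynamics of Λ by that of K_l costs a Lieb–Robinson error of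
order T‖V‖ e^{μ(vT - l)}, since only times |r| ≤ T enter. First-order errors carry a factor ‖V‖ and
sum to a multiple of C_W; second-order ones vanish as m grows. Hence m may depend on the volume
while the final bound does not.

This freedom is needed because each step compares outer eigenvalues at s with sector eigenvalues at
a nearby s'. Compactness makes their distance at least any prescribed g' < g, but on a scale without
uniform control (`IsGappedSector.exists_uniform_gap`). Taking T proportional to l so that g'T/2 =
μ(l - vT) gives the decay rate μg'/(g' + 2μv), which tends to 1/ξ as g' → g. The strict inequality
μ' < 1/ξ pays for g' < g and for the factor T.

The estimates are carried by `norm_heis_localSum_sub_le_aux` (Lieb–Robinson),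
`norm_I_mul_gaussFilter_exp_add_le` (filter), `exists_transport_step` and `exists_transport`, and
are joined in `exists_local_transport`. -/

noncomputable section

namespace QuantumSpin

set_option linter.unusedSectionVars false

/-! ### Embedding of local observables -/

section Embed

variable {Γ : Type u} [DecidableEq Γ] {n : Γ → ℕ}

/-- The configuration that agrees with `τ` on `X` and with `σ` elsewhere. -/
def override {X Y : Finset Γ} (σ : Conf n Y) (τ : Conf n X) : Conf n Y :=
  fun y => if hy : (y : Γ) ∈ X then τ ⟨y, hy⟩ else σ y

/-- The restriction of a configuration to a smaller set. -/
def restr {X Y : Finset Γ} (h : X ⊆ Y) (σ : Conf n Y) : Conf n X := fun x => σ ⟨x, h x.2⟩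

lemma restr_override {X Y : Finset Γ} (h : X ⊆ Y) (σ : Conf n Y) (τ : Conf n X) :
    restr h (override σ τ) = τ := by
  funext x
  simp [restr, override]

/-- A configuration agreeing with σ off X is determined by its values on X. This turns the matrix of
A ⊗ 1 into a sum over X alone. -/
lemma sum_agree {X Y : Finset Γ} (h : X ⊆ Y) (σ : Conf n Y) (f : Conf n Y → ℂ) :
    (∑ τ : Conf n Y, if ∀ y : Y, (y : Γ) ∉ X → σ y = τ y then f τ else 0)
      = ∑ ρ : Conf n X, f (override σ ρ) := by
  rw [← Finset.sum_filter]
  symm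
  refine Finset.sum_bij (fun ρ _ => override σ ρ) ?_ ?_ ?_ ?_
  · intro ρ _
    simp only [Finset.mem_filter, Finset.mem_univ, true_and]
    intro y hy
    simp [override, hy]
  · intro ρ _ ρ' _ heq
    rw [← restr_override h σ ρ, heq, restr_override]
  · intro τ hτ
    simp only [Finset.mem_filter, Finset.mem_univ, true_and] at hτ
    refine ⟨restr h τ, Finset.mem_univ _, ?_⟩
    funext y
    by_cases hy : (y : Γ) ∈ X
    · simp [override, restr, hy]
    · simp [override, hy, hτ y hy]
  · intros; rfl

lemma embed_apply {X Y : Finset Γ} (h : X ⊆ Y) (A : Op n X) (f : Hilb n Y) (σ : Conf n Y) :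
    embed h A f σ = ∑ ρ : Conf n X, toMat A (restr h σ) ρ * f (override σ ρ) := by
  have : embed h A f σ = ∑ τ : Conf n Y, if ∀ y : Y, (y : Γ) ∉ X → σ y = τ y then
      toMat A (restr h σ) (restr h τ) * f τ else 0 := by
    simp only [embed, Matrix.ofLp_toEuclideanCLM, Matrix.mulVec, dotProduct, Matrix.of_apply,
      ite_mul, zero_mul]
    rfl
  rw [this, sum_agree h σ (fun τ => toMat A (restr h σ) (restr h τ) * f τ)]
  simp [restr_override]

lemma op_ext {X : Finset Γ} {A B : Op n X} (h : ∀ f σ, A f σ = B f σ) : A = B := by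
  ext f σ
  exact h f σ

lemma toMat_mul {X : Finset Γ} (A B : Op n X) : toMat (A * B) = toMat A * toMat B := by
  simp [toMat]

lemma override_override {X Y : Finset Γ} (σ : Conf n Y) (τ ρ : Conf n X) :
    override (override σ τ) ρ = override σ ρ := by
  funext y
  by_cases hy : (y : Γ) ∈ X <;> simp [override, hy]

lemma override_restr {X Y : Finset Γ} (h : X ⊆ Y) (σ : Conf n Y) :
    override σ (restr h σ) = σ := by
  funext y
  by_cases hy : (y : Γ) ∈ X <;> simp [override, restr, hy]

lemma embed_one {X Y : Finset Γ} (h : X ⊆ Y) : embed h (1 : Op n X) = 1 := by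
  refine op_ext fun f σ => ?_
  rw [embed_apply]
  simp [toMat, Matrix.one_apply, override_restr]

lemma embed_mul {X Y : Finset Γ} (h : X ⊆ Y) (A B : Op n X) :
    embed h (A * B) = embed h A * embed h B := by
  refine op_ext fun f σ => ?_
  rw [mul_apply_eq_comp, embed_apply, embed_apply]
  simp only [embed_apply, restr_override, override_override, toMat_mul, Matrix.mul_apply,
    Finset.sum_mul, Finset.mul_sum]
  rw [Finset.sum_comm]
  simp [mul_assoc]

lemma embed_add {X Y : Finset Γ} (h : X ⊆ Y) (A B : Op n X) :
    embed h (A + B) = embed h A + embed h B := by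
  refine op_ext fun f σ => ?_
  simp [embed_apply, toMat, add_mul, Finset.sum_add_distrib]

lemma embed_smul {X Y : Finset Γ} (h : X ⊆ Y) (c : ℂ) (A : Op n X) :
    embed h (c • A) = c • embed h A := by
  refine op_ext fun f σ => ?_
  simp [embed_apply, toMat, mul_assoc, Finset.mul_sum]

lemma toMat_embed {X Y : Finset Γ} (h : X ⊆ Y) (A : Op n X) (σ τ : Conf n Y) :
    toMat (embed h A) σ τ = if ∀ y : Y, (y : Γ) ∉ X → σ y = τ y then
      toMat A (restr h σ) (restr h τ) else 0 := by
  rw [toMat, embed, StarAlgEquiv.symm_apply_apply]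
  rfl

lemma toMat_star {X : Finset Γ} (A : Op n X) : toMat (star A) = star (toMat A) :=
  (Matrix.toEuclideanCLM (n := Conf n X) (𝕜 := ℂ)).symm.map_star' A

lemma toMat_injective {X : Finset Γ} : Function.Injective (toMat (n := n) (X := X)) :=
  (Matrix.toEuclideanCLM (n := Conf n X) (𝕜 := ℂ)).symm.injective

lemma embed_star {X Y : Finset Γ} (h : X ⊆ Y) (A : Op n X) :
    embed h (star A) = star (embed h A) := by
  apply toMat_injective
  ext σ τ
  rw [toMat_star, Matrix.star_apply, toMat_embed, toMat_embed, toMat_star, Matrix.star_apply]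
  simp only [eq_comm (a := σ _), apply_ite star, star_zero]

/-- The identification `A ↦ A ⊗ 1` as a homomorphism of star algebras. -/
def embedHom {X Y : Finset Γ} (h : X ⊆ Y) : Op n X →⋆ₐ[ℂ] Op n Y where
  toFun := embed h
  map_one' := embed_one h
  map_mul' := embed_mul h
  map_zero' := by
    have h0 := embed_add h (0 : Op n X) 0
    rw [add_zero] at h0
    exact left_eq_add.1 h0
  map_add' := embed_add h
  commutes' c := by
    rw [Algebra.algebraMap_eq_smul_one, Algebra.algebraMap_eq_smul_one, embed_smul, embed_one]
  map_star' := embed_star h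

lemma embedHom_apply {X Y : Finset Γ} (h : X ⊆ Y) (A : Op n X) : embedHom h A = embed h A := rfl

/-- Star homomorphisms of C*-algebras are contractive. -/
lemma norm_embed_le {X Y : Finset Γ} (h : X ⊆ Y) (A : Op n X) : ‖embed h A‖ ≤ ‖A‖ :=
  NonUnitalStarAlgHom.norm_apply_le (embedHom h) A

lemma embed_embed {X Y Z : Finset Γ} (h : X ⊆ Y) (h' : Y ⊆ Z) (A : Op n X) :
    embed h' (embed h A) = embed (h.trans h') A := by
  refine op_ext fun f σ => ?_
  rw [embed_apply, embed_apply]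
  have key : ∀ τ : Conf n Y, toMat (embed h A) (restr h' σ) τ * f (override σ τ) =
      if ∀ y : Y, (y : Γ) ∉ X → restr h' σ y = τ y then
        toMat A (restr h (restr h' σ)) (restr h τ) * f (override σ τ) else 0 := by
    intro τ
    rw [toMat_embed, ite_mul, zero_mul]
  rw [Finset.sum_congr rfl fun τ _ => key τ, sum_agree h (restr h' σ)
    (fun τ => toMat A (restr h (restr h' σ)) (restr h τ) * f (override σ τ))]
  refine Finset.sum_congr rfl fun ρ _ => ?_
  rw [restr_override]
  congr 2
  refine congrArg f.ofLp (funext fun y => ?_)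
  by_cases hy : (y : Γ) ∈ Y
  · by_cases hx : (y : Γ) ∈ X <;> simp [override, restr, hy, hx]
  · have hx : (y : Γ) ∉ X := fun hx => hy (h hx)
    simp [override, hy, hx]

lemma embed_commute {X Y Z : Finset Γ} (hX : X ⊆ Z) (hY : Y ⊆ Z) (hd : Disjoint X Y)
    (A : Op n X) (B : Op n Y) : Commute (embed hX A) (embed hY B) := by
  refine op_ext fun f σ => ?_
  rw [mul_apply_eq_comp, mul_apply_eq_comp, embed_apply, embed_apply]
  have h1 : ∀ ρ : Conf n X, restr hY (override σ ρ) = restr hY σ := by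
    intro ρ
    funext y
    have : (y : Γ) ∉ X := fun hx => Finset.disjoint_left.1 hd hx y.2
    simp [restr, override, this]
  have h2 : ∀ ρ : Conf n Y, restr hX (override σ ρ) = restr hX σ := by
    intro ρ
    funext y
    have : (y : Γ) ∉ Y := fun hx => Finset.disjoint_left.1 hd y.2 hx
    simp [restr, override, this]
  have h3 : ∀ (ρ : Conf n X) (ρ' : Conf n Y),
      override (override σ ρ) ρ' = override (override σ ρ') ρ := by
    intro ρ ρ'
    funext y
    by_cases hx : (y : Γ) ∈ X
    · have hy : (y : Γ) ∉ Y := fun hy => Finset.disjoint_left.1 hd hx hy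
      simp [override, hx, hy]
    · by_cases hy : (y : Γ) ∈ Y <;> simp [override, hx, hy]
  simp only [embed_apply, h1, h2, h3, Finset.mul_sum]
  rw [Finset.sum_comm]
  refine Finset.sum_congr rfl fun _ _ => Finset.sum_congr rfl fun _ _ => ?_
  ring

end Embed

/-! ### Heisenberg dynamics and comparison of two evolutions -/

section Dynamics

variable {𝔄 : Type*} [CStarAlgebra 𝔄]

/-- The unitary group `e^{itH}`. -/
def evol (H : 𝔄) (t : ℝ) : 𝔄 := NormedSpace.exp (t • (Complex.I • H))

/-- The Heisenberg evolution `e^{itH} A e^{-itH}`. -/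
def heis (H A : 𝔄) (t : ℝ) : 𝔄 := evol H t * A * evol (-H) t

lemma evol_zero (H : 𝔄) : evol H 0 = 1 := by simp [evol]

lemma evol_mem_unitary {H : 𝔄} (hH : IsSelfAdjoint H) (t : ℝ) : evol H t ∈ unitary 𝔄 := by
  let _ : NormedAlgebra ℚ 𝔄 := .restrictScalars ℚ ℂ 𝔄
  refine NormedSpace.exp_mem_unitary_of_mem_skewAdjoint ?_
  rw [skewAdjoint.mem_iff]
  simp [hH.star_eq]

lemma star_evol {H : 𝔄} (hH : IsSelfAdjoint H) (t : ℝ) : star (evol H t) = evol (-H) t := by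
  rw [evol, evol, NormedSpace.star_exp]
  simp [hH.star_eq]

lemma evol_mul_evol_neg (H : 𝔄) (t : ℝ) : evol H t * evol (-H) t = 1 := by
  let _ : NormedAlgebra ℚ 𝔄 := .restrictScalars ℚ ℂ 𝔄
  rw [evol, evol, ← NormedSpace.exp_add_of_commute]
  · simp
  · simp only [smul_neg]
    exact (Commute.refl _).neg_right

lemma evol_neg_mul_evol (H : 𝔄) (t : ℝ) : evol (-H) t * evol H t = 1 := by
  simpa using evol_mul_evol_neg (-H) t

lemma hasDerivAt_evol (H : 𝔄) (t : ℝ) :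
    HasDerivAt (evol H) (evol H t * (Complex.I • H)) t :=
  hasDerivAt_exp_smul_const (𝕂 := ℝ) (Complex.I • H) t

lemma hasDerivAt_evol' (H : 𝔄) (t : ℝ) :
    HasDerivAt (evol H) ((Complex.I • H) * evol H t) t :=
  hasDerivAt_exp_smul_const' (𝕂 := ℝ) (Complex.I • H) t

lemma continuous_evol (H : 𝔄) : Continuous (evol H) :=
  continuous_iff_continuousAt.2 fun t => (hasDerivAt_evol H t).continuousAt

lemma continuous_heis (H A : 𝔄) : Continuous (heis H A) :=
  ((continuous_evol H).mul continuous_const).mul (continuous_evol (-H))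

lemma Commute.evol_right {A H : 𝔄} (h : Commute A H) (t : ℝ) : Commute A (evol H t) :=
  Commute.exp_right ((h.smul_right Complex.I).smul_right t)

lemma evol_add {H K : 𝔄} (h : Commute H K) (t : ℝ) : evol (H + K) t = evol H t * evol K t := by
  let _ : NormedAlgebra ℚ 𝔄 := .restrictScalars ℚ ℂ 𝔄
  rw [evol, smul_add, smul_add, NormedSpace.exp_add_of_commute]
  · rfl
  · exact (((h.smul_left Complex.I).smul_left t).smul_right Complex.I).smul_right t

lemma evol_neg (H : 𝔄) (t : ℝ) : evol H (-t) = evol (-H) t := by simp [evol]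

lemma norm_heis {H : 𝔄} (hH : IsSelfAdjoint H) (A : 𝔄) (t : ℝ) : ‖heis H A t‖ = ‖A‖ := by
  rw [heis, CStarRing.norm_mul_mem_unitary _ (evol_mem_unitary hH.neg t),
    CStarRing.norm_mem_unitary_mul _ (evol_mem_unitary hH t)]

lemma heis_selfAdjoint {H A : 𝔄} (hH : IsSelfAdjoint H) (hA : IsSelfAdjoint A) (t : ℝ) :
    IsSelfAdjoint (heis H A t) := by
  rw [IsSelfAdjoint, heis, star_mul, star_mul, star_evol hH, star_evol hH.neg, hA.star_eq, neg_neg,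
    mul_assoc]

lemma heis_add_of_commute {H K A : 𝔄} (hHK : Commute H K) (hA : Commute A K) (t : ℝ) :
    heis (H + K) A t = heis H A t := by
  have h1 : evol (H + K) t = evol H t * evol K t := evol_add hHK t
  have h2 : evol (-(H + K)) t = evol (-K) t * evol (-H) t := by
    rw [← evol_add (hHK.symm.neg_left.neg_right), neg_add, add_comm]
  have h3 : A * evol (-K) t = evol (-K) t * A := (Commute.evol_right hA.neg_right t).eq
  calc heis (H + K) A t
      = evol H t * evol K t * (A * evol (-K) t) * evol (-H) t := by
        rw [heis, h1, h2]; simp only [mul_assoc]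
    _ = evol H t * (evol K t * evol (-K) t) * A * evol (-H) t := by
        rw [h3]; simp only [mul_assoc]
    _ = heis H A t := by rw [evol_mul_evol_neg, mul_one, heis]

/-- Two Heisenberg evolutions of `A` are compared through the boundary parts `H - H₀` and
`H' - H₀'` of the generators, for reference generators that act on `A` in the same way. -/
lemma norm_heis_sub_heis_le {H H' H₀ H₀' A : 𝔄} (hH : IsSelfAdjoint H) (hH' : IsSelfAdjoint H')
    (hH₀ : IsSelfAdjoint H₀) (hH₀' : IsSelfAdjoint H₀') {r : ℝ} (hr : 0 ≤ r)
    (hA : heis H₀ A r = heis H₀' A r) {B B' : ℝ → ℝ} (hB0 : B 0 = 0)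
    (hB : ∀ t, HasDerivAt B (B' t) t)
    (hbound : ∀ t ∈ Ico 0 r, 2 * ‖A‖ * ‖heis H (H - H₀) t - heis H' (H' - H₀') t‖ ≤ B' t) :
    ‖heis H A r - heis H' A r‖ ≤ B r := by
  set A' := heis H₀ A r with hA'
  have hnA' : ‖A'‖ = ‖A‖ := norm_heis hH₀ A r
  -- Interaction picture: up to a unitary conjugation the difference to be bounded is g A' g* - A'.
  -- With the factors of H' and H adjacent, the derivative of g contains the two evolved boundary
  -- parts only through their difference, so the estimate can be iterated.
  set g : ℝ → 𝔄 := fun t => (evol H₀' t * evol (-H') t) * (evol H t * evol (-H₀) t) with hg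
  set d : ℝ → 𝔄 := fun t => (evol H₀' t * evol (-H') t) *
    (Complex.I • (heis H (H - H₀) t - heis H' (H' - H₀') t)) * (evol H t * evol (-H₀) t) with hd
  have hU : ∀ t, evol H t * evol (-H₀) t ∈ unitary 𝔄 := fun t =>
    mul_mem (evol_mem_unitary hH t) (evol_mem_unitary hH₀.neg t)
  have hU' : ∀ t, evol H₀' t * evol (-H') t ∈ unitary 𝔄 := fun t =>
    mul_mem (evol_mem_unitary hH₀' t) (evol_mem_unitary hH'.neg t)
  have hgu : ∀ t, g t ∈ unitary 𝔄 := fun t => mul_mem (hU' t) (hU t)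
  have hdn : ∀ t, ‖d t‖ = ‖heis H (H - H₀) t - heis H' (H' - H₀') t‖ := by
    intro t
    rw [hd, CStarRing.norm_mul_mem_unitary _ (hU t), CStarRing.norm_mem_unitary_mul _ (hU' t),
      norm_smul, Complex.norm_I, one_mul]
  have hgd : ∀ t, HasDerivAt g (d t) t := by
    intro t
    have h1 := ((hasDerivAt_evol H₀' t).mul (hasDerivAt_evol' (-H') t)).mul
      ((hasDerivAt_evol H t).mul (hasDerivAt_evol' (-H₀) t))
    refine h1.congr_deriv ?_
    have e1 := evol_neg_mul_evol H' t
    have e2 := evol_neg_mul_evol H t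
    have e3 : ∀ x : 𝔄, evol (-H') t * (evol H' t * x) = x := fun x => by
      rw [← mul_assoc, e1, one_mul]
    have e4 : ∀ x : 𝔄, evol (-H) t * (evol H t * x) = x := fun x => by
      rw [← mul_assoc, e2, one_mul]
    simp only [hd, heis, Pi.mul_apply, mul_sub, sub_mul, smul_sub, mul_assoc, smul_mul_assoc,
      mul_smul_comm, e3, e4, add_mul, mul_add, smul_neg, neg_mul, mul_neg]
    abel
  have key := image_norm_le_of_norm_deriv_right_le_deriv_boundary
    (f := fun t => g t * A' * star (g t) - A')
    (f' := fun t => d t * A' * star (g t) + g t * A' * star (d t)) (a := 0) (b := r) (B := B)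
    (B' := B') ?_ ?_ ?_ hB ?_ (right_mem_Icc.2 hr)
  · have e1 : heis H A r = (evol H r * evol (-H₀) r) * A' * star (evol H r * evol (-H₀) r) := by
      rw [star_mul, star_evol hH, star_evol hH₀.neg, neg_neg, hA', heis, heis]
      have e4 : ∀ x : 𝔄, evol (-H₀) r * (evol H₀ r * x) = x := fun x => by
        rw [← mul_assoc, evol_neg_mul_evol, one_mul]
      simp only [mul_assoc, e4]
    have e2 : heis H' A r = star (evol H₀' r * evol (-H') r) * A' * (evol H₀' r * evol (-H') r) := by
      rw [star_mul, star_evol hH₀', star_evol hH'.neg, neg_neg, hA, heis, heis]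
      have e4 : ∀ x : 𝔄, evol (-H₀') r * (evol H₀' r * x) = x := fun x => by
        rw [← mul_assoc, evol_neg_mul_evol, one_mul]
      simp only [mul_assoc, e4]
    have e3 : heis H A r - heis H' A r = star (evol H₀' r * evol (-H') r) *
        (g r * A' * star (g r) - A') * (evol H₀' r * evol (-H') r) := by
      have e4 := Unitary.star_mul_self_of_mem (hU' r)
      have e5 : ∀ x : 𝔄, star (evol H₀' r * evol (-H') r) * ((evol H₀' r * evol (-H') r) * x) = x :=
        fun x => by rw [← mul_assoc, e4, one_mul]
      rw [e1, e2, mul_sub, sub_mul]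
      congr 1
      rw [hg]
      dsimp only
      generalize evol H₀' r * evol (-H') r = w at *
      generalize evol H r * evol (-H₀) r = w' at *
      rw [star_mul]
      simp only [mul_assoc, e5, e4, mul_one]
    rw [e3, CStarRing.norm_mul_mem_unitary _ (hU' r),
      CStarRing.norm_mem_unitary_mul _ (Unitary.star_mem (hU' r))]
    exact key
  · intro t _
    exact ((((hgd t).mul_const A').mul (hgd t).star).sub_const A').continuousAt.continuousWithinAt
  · intro t _
    exact ((((hgd t).mul_const A').mul (hgd t).star).sub_const A').hasDerivWithinAt
  · simp [hg, evol_zero, hB0]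
  · intro t ht
    refine le_trans ?_ (hbound t ht)
    -- The derivative falls on g and on its adjoint; this is the factor 2 in `hbound`.
    refine (norm_add_le _ _).trans ?_
    have n1 : ‖d t * A' * star (g t)‖ ≤ ‖d t‖ * ‖A‖ := by
      rw [CStarRing.norm_mul_mem_unitary _ (Unitary.star_mem (hgu t)), ← hnA']
      exact norm_mul_le _ _
    have n2 : ‖g t * A' * star (d t)‖ ≤ ‖d t‖ * ‖A‖ := by
      rw [mul_assoc, CStarRing.norm_mem_unitary_mul _ (hgu t), ← hnA', mul_comm, ← norm_star (d t)]
      exact norm_mul_le _ _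
    rw [← hdn]
    linarith

end Dynamics

/-! ### Lieb–Robinson bound for restricting the dynamics to a subset -/

section LiebRobinson

variable {𝔄 : Type*} [CStarAlgebra 𝔄]

lemma heis_sum {ι : Type*} (S : Finset ι) (H : 𝔄) (a : ι → 𝔄) (t : ℝ) :
    heis H (∑ i ∈ S, a i) t = ∑ i ∈ S, heis H (a i) t := by
  simp [heis, Finset.mul_sum, Finset.sum_mul]

variable {Γ : Type u}

/-- The sum of the local terms `h Z` over all `Z ⊆ S`. -/
def localSum (h : Finset Γ → 𝔄) (S : Finset Γ) : 𝔄 := ∑ Z ∈ S.powerset, h Z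

lemma localSum_selfAdjoint {h : Finset Γ → 𝔄} (hsa : ∀ Z, IsSelfAdjoint (h Z)) (S : Finset Γ) :
    IsSelfAdjoint (localSum h S) := isSelfAdjoint_sum _ fun Z _ => hsa Z

variable [DecidableEq Γ]

/-- The sum of the local terms in `S` that are neither inside nor disjoint from `X`. -/
def boundarySum (h : Finset Γ → 𝔄) (S X : Finset Γ) : 𝔄 :=
  ∑ Z ∈ S.powerset with ¬ Z ⊆ X ∧ ¬ Disjoint Z X, h Z

/-- The sum of the local terms in `S` that are disjoint from `X`, the empty one excluded. -/
def exteriorSum (h : Finset Γ → 𝔄) (S X : Finset Γ) : 𝔄 :=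
  ∑ Z ∈ S.powerset with ¬ Z ⊆ X ∧ Disjoint Z X, h Z

/-- Interior and exterior terms form the reference generator. The remaining boundary sets have a
point in X and one outside, hence at least two sites. So single-site terms, however large, never
enter the velocity. -/
lemma localSum_eq (h : Finset Γ → 𝔄) {S X : Finset Γ} (hX : X ⊆ S) :
    localSum h S = (localSum h X + exteriorSum h S X) + boundarySum h S X := by
  have h1 : X.powerset = S.powerset.filter (· ⊆ X) := by
    ext Z
    simp only [Finset.mem_powerset, Finset.mem_filter]
    exact ⟨fun hZ => ⟨hZ.trans hX, hZ⟩, fun hZ => hZ.2⟩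
  rw [localSum, localSum, exteriorSum, boundarySum, h1, add_assoc,
    ← Finset.sum_filter_add_sum_filter_not S.powerset (· ⊆ X)]
  congr 1
  rw [← Finset.sum_filter_add_sum_filter_not (S.powerset.filter fun Z => ¬ Z ⊆ X)
    (fun Z => Disjoint Z X), Finset.filter_filter, Finset.filter_filter]

/-- Exterior terms commute with A and with everything inside X, so they drop out. The reference
dynamics of A is therefore the same for S = Λ and S = Ω, as the comparison lemma demands. -/
lemma heis_localSum_add_exteriorSum {h : Finset Γ → 𝔄} {Λ S X : Finset Γ} (hS : S ⊆ Λ)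
    (hX : X ⊆ S)
    (hcomm : ∀ Z ⊆ Λ, ∀ Z' ⊆ Λ, Disjoint Z Z' → Commute (h Z) (h Z')) {A : 𝔄}
    (hA : ∀ Z ⊆ Λ, Disjoint Z X → Commute A (h Z)) (t : ℝ) :
    heis (localSum h X + exteriorSum h S X) A t = heis (localSum h X) A t := by
  refine heis_add_of_commute ?_ ?_ t
  · refine Commute.sum_left _ _ _ fun Z hZ => Commute.sum_right _ _ _ fun Z' hZ' => ?_
    simp only [Finset.mem_powerset, Finset.mem_filter] at hZ hZ'
    exact hcomm Z (hZ.trans (hX.trans hS)) Z' (hZ'.1.trans hS) (hZ'.2.2.mono_right hZ).symm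
  · refine Commute.sum_right _ _ _ fun Z hZ => ?_
    simp only [Finset.mem_powerset, Finset.mem_filter] at hZ
    exact hA Z (hZ.1.trans hS) hZ.2.2

/-- The profile of the Lieb--Robinson bound for the comparison with the dynamics in `Ω`. -/
def lrProfile (f : Γ → Γ → ℝ) (J C : ℝ) (Λ Ω : Finset Γ) (x : Γ) (t : ℝ) : ℝ :=
  (if x ∈ Ω then 0 else 1) + (Real.exp (2 * J * C * t) - 1) / C * ∑ y ∈ Λ \ Ω, f x y

lemma lrProfile_nonneg {f : Γ → Γ → ℝ} (hf : ∀ x y, 0 ≤ f x y) {J C : ℝ} (hJ : 0 ≤ J)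
    (hC : 0 < C) (Λ Ω : Finset Γ) (x : Γ) {t : ℝ} (ht : 0 ≤ t) :
    0 ≤ lrProfile f J C Λ Ω x t := by
  have h1 : 0 ≤ Real.exp (2 * J * C * t) - 1 := by
    have := Real.one_le_exp (x := 2 * J * C * t) (by positivity)
    linarith
  have h2 : 0 ≤ ∑ y ∈ Λ \ Ω, f x y := Finset.sum_nonneg fun y _ => hf x y
  unfold lrProfile
  split_ifs <;> positivity

/-- Convolving the profile with f gives back an exponential, by the convolution property. Thus the
profile reproduces itself under the integral inequality for the Lieb–Robinson error. -/
lemma sum_mul_lrProfile_le {f : Γ → Γ → ℝ} {J C : ℝ} (hJ : 0 ≤ J)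
    (hC : 0 < C) {Λ Ω : Finset Γ}
    (hconv : ∀ x ∈ Λ, ∀ y ∈ Λ, ∑ z ∈ Λ, f x z * f z y ≤ C * f x y) {x : Γ} (hx : x ∈ Λ) {t : ℝ}
    (ht : 0 ≤ t) :
    ∑ z ∈ Λ, f x z * lrProfile f J C Λ Ω z t
      ≤ Real.exp (2 * J * C * t) * ∑ y ∈ Λ \ Ω, f x y := by
  have h1 : 0 ≤ Real.exp (2 * J * C * t) - 1 := by
    have := Real.one_le_exp (x := 2 * J * C * t) (by positivity)
    linarith
  have e1 : ∑ z ∈ Λ, f x z * (if z ∈ Ω then 0 else 1) = ∑ y ∈ Λ \ Ω, f x y := by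
    rw [Finset.sdiff_eq_filter, Finset.sum_filter]
    refine Finset.sum_congr rfl fun z _ => ?_
    by_cases hz : z ∈ Ω <;> simp [hz]
  have e2 : ∑ z ∈ Λ, f x z * ∑ y ∈ Λ \ Ω, f z y ≤ C * ∑ y ∈ Λ \ Ω, f x y := by
    simp only [Finset.mul_sum]
    rw [Finset.sum_comm]
    exact Finset.sum_le_sum fun y hy => by
      simpa using hconv x hx y (Finset.mem_sdiff.1 hy).1
  calc ∑ z ∈ Λ, f x z * lrProfile f J C Λ Ω z t
      = ∑ y ∈ Λ \ Ω, f x y + (Real.exp (2 * J * C * t) - 1) / C *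
          ∑ z ∈ Λ, f x z * ∑ y ∈ Λ \ Ω, f z y := by
        rw [← e1, Finset.mul_sum, ← Finset.sum_add_distrib]
        refine Finset.sum_congr rfl fun z _ => ?_
        rw [lrProfile]
        ring
    _ ≤ ∑ y ∈ Λ \ Ω, f x y + (Real.exp (2 * J * C * t) - 1) / C *
          (C * ∑ y ∈ Λ \ Ω, f x y) := by gcongr
    _ = _ := by field_simp; ring

/-- Each boundary set contains some x in X and has more than one element. Overcounting by summing
over all such x and exchanging the sums leaves, for each pair x, z, the total strength of the sets
containing both. -/
lemma sum_boundary_le {Λ X : Finset Γ} (hX : X ⊆ Λ) {a : Finset Γ → ℝ} (ha : ∀ Z, 0 ≤ a Z)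
    {w : Γ → ℝ} (hw : ∀ x, 0 ≤ w x) {f : Γ → Γ → ℝ} {J : ℝ}
    (hJf : ∀ x ∈ Λ, ∀ z ∈ Λ,
      ∑ Z ∈ Λ.powerset with (x ∈ Z ∧ z ∈ Z) ∧ 1 < Z.card, a Z ≤ J * f x z) :
    ∑ Z ∈ Λ.powerset with ¬ Z ⊆ X ∧ ¬ Disjoint Z X, a Z * ∑ z ∈ Z, w z
      ≤ J * ∑ x ∈ X, ∑ z ∈ Λ, f x z * w z := by
  have key : ∀ Z ∈ Λ.powerset.filter (fun Z => ¬ Z ⊆ X ∧ ¬ Disjoint Z X),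
      a Z * ∑ z ∈ Z, w z ≤ ∑ x ∈ X, ∑ z ∈ Λ,
        if (x ∈ Z ∧ z ∈ Z) ∧ 1 < Z.card then a Z * w z else 0 := by
    intro Z hZ
    simp only [Finset.mem_filter, Finset.mem_powerset] at hZ
    obtain ⟨hZΛ, hZX, hd⟩ := hZ
    obtain ⟨x, hxZ, hxX⟩ := Finset.not_disjoint_iff.1 hd
    obtain ⟨y, hyZ, hyX⟩ := Finset.not_subset.1 hZX
    have hcard : 1 < Z.card :=
      Finset.one_lt_card.2 ⟨x, hxZ, y, hyZ, fun hxy => hyX (hxy ▸ hxX)⟩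
    refine le_trans (le_of_eq ?_) (Finset.single_le_sum (f := fun x => ∑ z ∈ Λ,
        if (x ∈ Z ∧ z ∈ Z) ∧ 1 < Z.card then a Z * w z else 0)
      (fun x _ => Finset.sum_nonneg fun z _ => ?_) hxX)
    · rw [← Finset.sum_filter, Finset.mul_sum]
      refine Finset.sum_congr ?_ fun _ _ => rfl
      ext z
      simp only [Finset.mem_filter, hxZ, hcard, true_and, and_true]
      exact ⟨fun hz => ⟨hZΛ hz, hz⟩, fun hz => hz.2⟩
    · split_ifs
      · exact mul_nonneg (ha Z) (hw z)
      · exact le_rfl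
  have nn : ∀ Z ∈ Λ.powerset, 0 ≤ ∑ x ∈ X, ∑ z ∈ Λ,
        if (x ∈ Z ∧ z ∈ Z) ∧ 1 < Z.card then a Z * w z else 0 := by
    intro Z _
    refine Finset.sum_nonneg fun x _ => Finset.sum_nonneg fun z _ => ?_
    split_ifs
    · exact mul_nonneg (ha Z) (hw z)
    · exact le_rfl
  refine (Finset.sum_le_sum key).trans ((Finset.sum_le_sum_of_subset_of_nonneg
    (Finset.filter_subset _ _) fun Z hZ _ => nn Z hZ).trans ?_)
  rw [Finset.sum_comm, Finset.mul_sum]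
  refine Finset.sum_le_sum fun x hx => ?_
  rw [Finset.sum_comm, Finset.mul_sum]
  refine Finset.sum_le_sum fun z hz => ?_
  rw [← Finset.sum_filter, ← Finset.sum_mul, ← mul_assoc]
  exact mul_le_mul_of_nonneg_right (hJf x (hX hx) z hz) (hw z)

/-- Iteration of the integral inequality, m times. The remainder starts from the trivial bound 2‖A‖
and gains a factor κt/m at the m-th iteration, so it vanishes in the limit whatever the
volume-dependent κ is. -/
lemma norm_heis_localSum_sub_le_aux {h : Finset Γ → 𝔄} (hsa : ∀ Z, IsSelfAdjoint (h Z))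
    {Λ Ω : Finset Γ} (hΩ : Ω ⊆ Λ)
    (hcomm : ∀ Z ⊆ Λ, ∀ Z' ⊆ Λ, Disjoint Z Z' → Commute (h Z) (h Z'))
    {f : Γ → Γ → ℝ} (hf : ∀ x y, 0 ≤ f x y) {J C : ℝ} (hJ : 0 ≤ J) (hC : 0 < C)
    (hconv : ∀ x ∈ Λ, ∀ y ∈ Λ, ∑ z ∈ Λ, f x z * f z y ≤ C * f x y)
    (hJf : ∀ x ∈ Λ, ∀ z ∈ Λ,
      ∑ Z ∈ Λ.powerset with (x ∈ Z ∧ z ∈ Z) ∧ 1 < Z.card, ‖h Z‖ ≤ J * f x z) (m : ℕ) :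
    ∀ (X : Finset Γ) (_ : X ⊆ Ω) (A : 𝔄) (_ : ∀ Z ⊆ Λ, Disjoint Z X → Commute A (h Z)) (t : ℝ)
      (_ : 0 ≤ t), ‖heis (localSum h Λ) A t - heis (localSum h Ω) A t‖
        ≤ ‖A‖ * (∑ x ∈ X, lrProfile f J C Λ Ω x t +
          2 * (((2 * ∑ Z ∈ Λ.powerset, ‖h Z‖) * t) ^ m / m.factorial)) := by
  set κ := 2 * ∑ Z ∈ Λ.powerset, ‖h Z‖ with hκ
  have hκ0 : 0 ≤ κ := by positivity
  have hHΛ := localSum_selfAdjoint hsa Λ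
  have hHΩ := localSum_selfAdjoint hsa Ω
  induction m with
  | zero =>
    intro X hX A hA t ht
    have h1 : 0 ≤ ∑ x ∈ X, lrProfile f J C Λ Ω x t :=
      Finset.sum_nonneg fun x _ => lrProfile_nonneg hf hJ hC Λ Ω x ht
    have h2 := norm_sub_le (heis (localSum h Λ) A t) (heis (localSum h Ω) A t)
    rw [norm_heis hHΛ, norm_heis hHΩ] at h2
    have h3 := mul_nonneg (norm_nonneg A) h1
    simp only [pow_zero, Nat.factorial_zero, Nat.cast_one]
    linarith
  | succ m ih =>
    intro X hX A hA r hr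
    have hXΛ := hX.trans hΩ
    have hex : ∀ S, IsSelfAdjoint (localSum h X + exteriorSum h S X) := fun S =>
      (localSum_selfAdjoint hsa X).add (isSelfAdjoint_sum _ fun Z _ => hsa Z)
    have hbd : ∀ S, X ⊆ S → localSum h S - (localSum h X + exteriorSum h S X)
        = boundarySum h S X := fun S hS => by rw [localSum_eq h hS]; abel
    have hprof : ∑ x ∈ X, lrProfile f J C Λ Ω x r =
        ∑ x ∈ X, (Real.exp (2 * J * C * r) - 1) / C * ∑ y ∈ Λ \ Ω, f x y :=
      Finset.sum_congr rfl fun x hx => by simp [lrProfile, hX hx]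
    rw [hprof, ← Finset.mul_sum]
    set S := ∑ x ∈ X, ∑ y ∈ Λ \ Ω, f x y with hS
    refine norm_heis_sub_heis_le hHΛ hHΩ (hex Λ) (hex Ω) hr
      (B := fun r => ‖A‖ * ((Real.exp (2 * J * C * r) - 1) / C * S +
          2 * ((κ * r) ^ (m + 1) / (m + 1).factorial)))
      (B' := fun r => ‖A‖ * (2 * J * Real.exp (2 * J * C * r) * S +
          2 * κ * ((κ * r) ^ m / m.factorial))) ?_ ?_ ?_ ?_
    · rw [heis_localSum_add_exteriorSum subset_rfl hXΛ hcomm hA,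
        heis_localSum_add_exteriorSum hΩ hX hcomm hA]
    · simp
    · intro t
      have d1 : HasDerivAt (fun r => Real.exp (2 * J * C * r))
          (Real.exp (2 * J * C * t) * (2 * J * C * 1)) t :=
        ((hasDerivAt_id t).const_mul (2 * J * C)).exp
      have d2 : HasDerivAt (fun r => (κ * r) ^ (m + 1)) ((m + 1 : ℕ) * (κ * t) ^ m * (κ * 1)) t :=
        ((hasDerivAt_id t).const_mul κ).pow (m + 1)
      refine (((((d1.sub_const 1).div_const C).mul_const S).add
        ((d2.div_const ((m + 1).factorial : ℝ)).const_mul 2)).const_mul ‖A‖).congr_deriv ?_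
      rw [Nat.factorial_succ]
      push_cast
      have : (m.factorial : ℝ) ≠ 0 := by positivity
      field_simp
    · intro t ht
      have ht0 : 0 ≤ t := ht.1
      set R := 2 * ((κ * t) ^ m / m.factorial) with hR
      have hR0 : 0 ≤ R := by positivity
      have hu : ∀ x, 0 ≤ lrProfile f J C Λ Ω x t := fun x =>
        lrProfile_nonneg hf hJ hC Λ Ω x ht0
      rw [hbd Λ hXΛ, hbd Ω hX]
      have split : heis (localSum h Λ) (boundarySum h Λ X) t
          - heis (localSum h Ω) (boundarySum h Ω X) t
          = ∑ Z ∈ Λ.powerset with ¬ Z ⊆ X ∧ ¬ Disjoint Z X,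
            (heis (localSum h Λ) (h Z) t - if Z ⊆ Ω then heis (localSum h Ω) (h Z) t else 0) := by
        rw [Finset.sum_sub_distrib, ← Finset.sum_filter, boundarySum, boundarySum, heis_sum,
          heis_sum]
        congr 1
        refine Finset.sum_congr ?_ fun _ _ => rfl
        ext Z
        simp only [Finset.mem_filter, Finset.mem_powerset]
        exact ⟨fun hZ => ⟨⟨hZ.1.trans hΩ, hZ.2⟩, hZ.1⟩, fun hZ => ⟨hZ.2, hZ.1.2⟩⟩
      have term : ∀ Z ∈ Λ.powerset.filter (fun Z => ¬ Z ⊆ X ∧ ¬ Disjoint Z X),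
          ‖heis (localSum h Λ) (h Z) t - if Z ⊆ Ω then heis (localSum h Ω) (h Z) t else 0‖
            ≤ ‖h Z‖ * ∑ z ∈ Z, lrProfile f J C Λ Ω z t + ‖h Z‖ * R := by
        intro Z hZ
        simp only [Finset.mem_filter, Finset.mem_powerset] at hZ
        split_ifs with hZΩ
        · rw [← mul_add]
          exact ih Z hZΩ (h Z) (fun Z' hZ' hd => hcomm Z hZ.1 Z' hZ' hd.symm) t ht0
        -- Such a term is absent from the dynamics of Ω, so there is nothing to compare. Its full
        -- norm is covered because the profile is at least 1 at a site outside Ω.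
        · obtain ⟨z, hz, hzΩ⟩ := Finset.not_subset.1 hZΩ
          have h1 : 1 ≤ ∑ z ∈ Z, lrProfile f J C Λ Ω z t := by
            refine le_trans ?_ (Finset.single_le_sum (fun z _ => hu z) hz)
            have h2 : 0 ≤ Real.exp (2 * J * C * t) - 1 := by
              have := Real.one_le_exp (x := 2 * J * C * t) (by positivity)
              linarith
            have h3 : 0 ≤ ∑ y ∈ Λ \ Ω, f z y := Finset.sum_nonneg fun y _ => hf z y
            have h4 : 0 ≤ (Real.exp (2 * J * C * t) - 1) / C * ∑ y ∈ Λ \ Ω, f z y := by positivity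
            simp only [lrProfile, hzΩ, if_false]
            linarith
          rw [sub_zero, norm_heis hHΛ]
          have h5 := mul_le_mul_of_nonneg_left h1 (norm_nonneg (h Z))
          have h6 := mul_nonneg (norm_nonneg (h Z)) hR0
          linarith
      have b1 : ∑ Z ∈ Λ.powerset with ¬ Z ⊆ X ∧ ¬ Disjoint Z X,
          ‖h Z‖ * ∑ z ∈ Z, lrProfile f J C Λ Ω z t ≤ J * (Real.exp (2 * J * C * t) * S) := by
        refine (sum_boundary_le hXΛ (fun Z => norm_nonneg (h Z)) hu hJf).trans ?_
        refine mul_le_mul_of_nonneg_left ?_ hJ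
        rw [hS, Finset.mul_sum]
        exact Finset.sum_le_sum fun x hx => sum_mul_lrProfile_le hJ hC hconv (hXΛ hx) ht0
      have b2 : ∑ Z ∈ Λ.powerset with ¬ Z ⊆ X ∧ ¬ Disjoint Z X, ‖h Z‖ * R ≤ κ / 2 * R := by
        rw [← Finset.sum_mul]
        refine mul_le_mul_of_nonneg_right ?_ hR0
        rw [hκ, mul_div_cancel_left₀ _ two_ne_zero]
        exact Finset.sum_le_sum_of_subset_of_nonneg (Finset.filter_subset _ _)
          fun Z _ _ => norm_nonneg _
      have b3 : ‖heis (localSum h Λ) (boundarySum h Λ X) t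
          - heis (localSum h Ω) (boundarySum h Ω X) t‖
          ≤ J * (Real.exp (2 * J * C * t) * S) + κ / 2 * R := by
        rw [split]
        refine (norm_sum_le_of_le _ term).trans ?_
        rw [Finset.sum_add_distrib]
        exact add_le_add b1 b2
      calc _ ≤ 2 * ‖A‖ * (J * (Real.exp (2 * J * C * t) * S) + κ / 2 * R) := by gcongr
        _ = _ := by rw [hR]; ring

/-- The dynamics of `H = ∑ h Z` over `Z ⊆ Λ` and its restriction to `Z ⊆ Ω` agree on observables in
`X ⊆ Ω` up to a Lieb--Robinson error. -/
lemma norm_heis_localSum_sub_le {h : Finset Γ → 𝔄} (hsa : ∀ Z, IsSelfAdjoint (h Z))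
    {Λ Ω : Finset Γ} (hΩ : Ω ⊆ Λ)
    (hcomm : ∀ Z ⊆ Λ, ∀ Z' ⊆ Λ, Disjoint Z Z' → Commute (h Z) (h Z'))
    {f : Γ → Γ → ℝ} (hf : ∀ x y, 0 ≤ f x y) {J C : ℝ} (hJ : 0 ≤ J) (hC : 0 < C)
    (hconv : ∀ x ∈ Λ, ∀ y ∈ Λ, ∑ z ∈ Λ, f x z * f z y ≤ C * f x y)
    (hJf : ∀ x ∈ Λ, ∀ z ∈ Λ,
      ∑ Z ∈ Λ.powerset with (x ∈ Z ∧ z ∈ Z) ∧ 1 < Z.card, ‖h Z‖ ≤ J * f x z)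
    {X : Finset Γ} (hX : X ⊆ Ω) {A : 𝔄} (hA : ∀ Z ⊆ Λ, Disjoint Z X → Commute A (h Z)) {t : ℝ}
    (ht : 0 ≤ t) :
    ‖heis (localSum h Λ) A t - heis (localSum h Ω) A t‖
      ≤ ‖A‖ * ((Real.exp (2 * J * C * t) - 1) / C * ∑ x ∈ X, ∑ y ∈ Λ \ Ω, f x y) := by
  have hprof : ∑ x ∈ X, lrProfile f J C Λ Ω x t =
      (Real.exp (2 * J * C * t) - 1) / C * ∑ x ∈ X, ∑ y ∈ Λ \ Ω, f x y := by
    rw [Finset.mul_sum]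
    exact Finset.sum_congr rfl fun x hx => by simp [lrProfile, hX hx]
  have lim : Filter.Tendsto (fun m : ℕ => ‖A‖ * (∑ x ∈ X, lrProfile f J C Λ Ω x t +
      2 * (((2 * ∑ Z ∈ Λ.powerset, ‖h Z‖) * t) ^ m / m.factorial))) Filter.atTop
      (nhds (‖A‖ * (∑ x ∈ X, lrProfile f J C Λ Ω x t + 2 * 0))) :=
    (((FloorSemiring.tendsto_pow_div_factorial_atTop _).const_mul 2).const_add _).const_mul _
  have := ge_of_tendsto' lim fun m =>
    norm_heis_localSum_sub_le_aux hsa hΩ hcomm hf hJ hC hconv hJf m X hX A hA t ht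
  rwa [mul_zero, add_zero, hprof] at this

/-- The two-sided version in time of `norm_heis_localSum_sub_le`. -/
lemma norm_heis_localSum_sub_le_abs {h : Finset Γ → 𝔄} (hsa : ∀ Z, IsSelfAdjoint (h Z))
    {Λ Ω : Finset Γ} (hΩ : Ω ⊆ Λ)
    (hcomm : ∀ Z ⊆ Λ, ∀ Z' ⊆ Λ, Disjoint Z Z' → Commute (h Z) (h Z'))
    {f : Γ → Γ → ℝ} (hf : ∀ x y, 0 ≤ f x y) {J C : ℝ} (hJ : 0 ≤ J) (hC : 0 < C)
    (hconv : ∀ x ∈ Λ, ∀ y ∈ Λ, ∑ z ∈ Λ, f x z * f z y ≤ C * f x y)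
    (hJf : ∀ x ∈ Λ, ∀ z ∈ Λ,
      ∑ Z ∈ Λ.powerset with (x ∈ Z ∧ z ∈ Z) ∧ 1 < Z.card, ‖h Z‖ ≤ J * f x z)
    {X : Finset Γ} (hX : X ⊆ Ω) {A : 𝔄} (hA : ∀ Z ⊆ Λ, Disjoint Z X → Commute A (h Z)) (t : ℝ) :
    ‖heis (localSum h Λ) A t - heis (localSum h Ω) A t‖
      ≤ ‖A‖ * ((Real.exp (2 * J * C * |t|) - 1) / C * ∑ x ∈ X, ∑ y ∈ Λ \ Ω, f x y) := by
  rcases le_total 0 t with ht | ht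
  · rw [abs_of_nonneg ht]
    exact norm_heis_localSum_sub_le hsa hΩ hcomm hf hJ hC hconv hJf hX hA ht
  · rw [abs_of_nonpos ht]
    have hneg : ∀ S, localSum (fun Z => -h Z) S = -localSum h S := fun S => by simp [localSum]
    have hflip : ∀ H : 𝔄, heis (-H) A (-t) = heis H A t := fun H => by
      simp [heis, evol_neg]
    -- Reversing time amounts to changing the sign of all local terms.
    have := norm_heis_localSum_sub_le (h := fun Z => -h Z) (fun Z => (hsa Z).neg) hΩ
      (fun Z hZ Z' hZ' hd => (hcomm Z hZ Z' hZ' hd).neg_left.neg_right) hf hJ hC hconv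
      (by simpa only [norm_neg] using hJf) hX (fun Z hZ hd => (hA Z hZ hd).neg_right)
      (neg_nonneg.2 ht)
    rwa [hneg, hneg, hflip, hflip] at this

end LiebRobinson

/-! ### The Gaussian filter -/

section Filter

open MeasureTheory

/-- The centred Gaussian probability density proportional to `e^{-α u²}`. -/
def gaussDensity (α u : ℝ) : ℝ := √(α / Real.pi) * Real.exp (-α * u ^ 2)

lemma gaussDensity_nonneg (α u : ℝ) : 0 ≤ gaussDensity α u := by unfold gaussDensity; positivity

lemma continuous_gaussDensity (α : ℝ) : Continuous (gaussDensity α) := by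
  unfold gaussDensity; fun_prop

lemma integrable_gaussDensity {α : ℝ} (hα : 0 < α) : Integrable (gaussDensity α) :=
  (integrable_exp_neg_mul_sq hα).const_mul _

lemma integral_gaussDensity {α : ℝ} (hα : 0 < α) : ∫ u, gaussDensity α u = 1 := by
  unfold gaussDensity
  rw [integral_const_mul, integral_gaussian, ← Real.sqrt_mul (by positivity)]
  have : α / Real.pi * (Real.pi / α) = 1 := by field_simp
  rw [this, Real.sqrt_one]

/-- Shift by T and use (u + T)² ≥ u² + T² for u ≥ 0; half of the unit mass remains. -/
lemma integral_gaussDensity_Ioi_le {α : ℝ} (hα : 0 < α) {T : ℝ} (hT : 0 ≤ T) :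
    ∫ u in Ioi T, gaussDensity α u ≤ Real.exp (-α * T ^ 2) / 2 := by
  have h1 : ∫ u in Ioi T, gaussDensity α u = ∫ u in Ioi 0, gaussDensity α (u + T) := by
    have := (measurePreserving_add_right volume T).setIntegral_preimage_emb
      (measurableEmbedding_addRight T) (gaussDensity α) (Ioi T)
    rw [← this, preimage_add_const_Ioi, sub_self]
  have h2 : ∫ u in Ioi (0 : ℝ), gaussDensity α u = 1 / 2 := by
    unfold gaussDensity
    rw [integral_const_mul, integral_gaussian_Ioi, ← mul_div_assoc,
      ← Real.sqrt_mul (by positivity)]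
    have : α / Real.pi * (Real.pi / α) = 1 := by field_simp
    rw [this, Real.sqrt_one]
  rw [h1]
  calc ∫ u in Ioi (0 : ℝ), gaussDensity α (u + T)
      ≤ ∫ u in Ioi (0 : ℝ), Real.exp (-α * T ^ 2) * gaussDensity α u := by
        refine setIntegral_mono_on ?_ ?_ measurableSet_Ioi ?_
        · exact ((integrable_gaussDensity hα).comp_add_right T).integrableOn
        · exact ((integrable_gaussDensity hα).const_mul _).integrableOn
        · intro u hu
          have hu : 0 < u := hu
          unfold gaussDensity
          rw [mul_left_comm, ← Real.exp_add]
          gcongr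
          have : 0 ≤ α * (u * T) := by positivity
          nlinarith
    _ = Real.exp (-α * T ^ 2) / 2 := by rw [integral_const_mul, h2]; ring

lemma integral_gaussDensity_compl_le {α : ℝ} (hα : 0 < α) {T : ℝ} (hT : 0 ≤ T) :
    ∫ u in (Ioc (-T) T)ᶜ, gaussDensity α u ≤ Real.exp (-α * T ^ 2) := by
  have hset : (Ioc (-T) T)ᶜ = Iic (-T) ∪ Ioi T := by
    ext x
    simp only [mem_compl_iff, mem_Ioc, mem_union, mem_Iic, mem_Ioi]
    by_cases h : -T < x <;> simp [h, not_le.2, not_lt.1]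
  have hdisj : Disjoint (Iic (-T)) (Ioi T) := by
    rw [Set.disjoint_left]
    intro x hx hx'
    simp only [mem_Iic, mem_Ioi] at hx hx'
    linarith
  have hleft : ∫ u in Iic (-T), gaussDensity α u = ∫ u in Ioi T, gaussDensity α u := by
    rw [← integral_comp_neg_Ioi]
    simp [gaussDensity]
  rw [hset, setIntegral_union hdisj measurableSet_Ioi (integrable_gaussDensity hα).integrableOn
    (integrable_gaussDensity hα).integrableOn, hleft]
  linarith [integral_gaussDensity_Ioi_le hα hT]

lemma norm_integral_sub_truncated_le {α : ℝ} (hα : 0 < α) {T : ℝ} (hT : 0 ≤ T) {f : ℝ → ℂ}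
    (hf : Integrable f) (hb : ∀ u, ‖f u‖ ≤ gaussDensity α u) :
    ‖(∫ u, f u) - ∫ u in -T..T, f u‖ ≤ Real.exp (-α * T ^ 2) := by
  rw [intervalIntegral.integral_of_le (by linarith), ← integral_add_compl
    (measurableSet_Ioc (a := -T) (b := T)) hf, add_sub_cancel_left]
  refine (norm_integral_le_of_norm_le (integrable_gaussDensity hα).integrableOn
    (Filter.Eventually.of_forall hb)).trans (integral_gaussDensity_compl_le hα hT)

lemma integral_gaussDensity_interval_le {α : ℝ} (hα : 0 < α) {T : ℝ} (hT : 0 ≤ T) :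
    ∫ u in -T..T, gaussDensity α u ≤ 1 := by
  rw [intervalIntegral.integral_of_le (by linarith), ← integral_gaussDensity hα]
  exact setIntegral_le_integral (integrable_gaussDensity hα)
    (Filter.Eventually.of_forall (gaussDensity_nonneg α))

lemma integral_gaussDensity_mul_exp {α : ℝ} (hα : 0 < α) (ν : ℝ) :
    ∫ u : ℝ, (gaussDensity α u : ℂ) * Complex.exp (Complex.I * u * ν)
      = Real.exp (-ν ^ 2 / (4 * α)) := by
  have h := fourierIntegral_gaussian (b := (α : ℂ)) (by simpa using hα) ν
  have h2 : ∀ u : ℝ, (gaussDensity α u : ℂ) * Complex.exp (Complex.I * u * ν)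
      = (√(α / Real.pi) : ℂ) *
        (Complex.exp (Complex.I * ν * u) * Complex.exp (-α * (u : ℂ) ^ 2)) := by
    intro u
    unfold gaussDensity
    push_cast
    rw [show Complex.I * (u : ℂ) * ν = Complex.I * ν * u by ring]
    ring
  simp only [h2]
  rw [integral_const_mul, h]
  have h3 : ((Real.pi : ℂ) / α) ^ (1 / 2 : ℂ) = (√(Real.pi / α) : ℝ) := by
    rw [Real.sqrt_eq_rpow, Complex.ofReal_cpow (by positivity)]
    push_cast
    rfl
  rw [h3, ← mul_assoc, ← Complex.ofReal_mul, ← Real.sqrt_mul (by positivity)]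
  have : α / Real.pi * (Real.pi / α) = 1 := by field_simp
  rw [this, Real.sqrt_one]
  push_cast
  ring_nf

/-- A time average of the primitive of `c` with Gaussian weights, cut off at time `T`. -/
def gaussFilter {E : Type*} [NormedAddCommGroup E] [NormedSpace ℝ E] (α T : ℝ) (c : ℝ → E) : E :=
  ∫ u in -T..T, gaussDensity α u • ∫ r in (0 : ℝ)..u, c r

variable {E : Type*} [NormedAddCommGroup E] [NormedSpace ℝ E]

lemma continuous_primitive {c : ℝ → E} (hc : Continuous c) :
    Continuous fun u => ∫ r in (0 : ℝ)..u, c r :=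
  intervalIntegral.continuous_primitive (fun _ _ => hc.intervalIntegrable _ _) 0

lemma intervalIntegrable_filter {α T : ℝ} {c : ℝ → E} (hc : Continuous c) :
    IntervalIntegrable (fun u => gaussDensity α u • ∫ r in (0 : ℝ)..u, c r) volume (-T) T :=
  ((continuous_gaussDensity α).smul (continuous_primitive hc)).intervalIntegrable _ _

/-- The primitive is at most T M on [-T, T] and the Gaussian mass at most 1. A bound on c at times
|r| ≤ T suffices, which is what makes Lieb–Robinson estimates applicable. -/
lemma norm_gaussFilter_le {α T M : ℝ} (hα : 0 < α) (hT : 0 ≤ T) (hM : 0 ≤ M) {c : ℝ → E}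
    (hb : ∀ r, |r| ≤ T → ‖c r‖ ≤ M) : ‖gaussFilter α T c‖ ≤ T * M := by
  have h1 : ∀ u ∈ Ioc (-T) T, ‖gaussDensity α u • ∫ r in (0 : ℝ)..u, c r‖
      ≤ gaussDensity α u * (T * M) := by
    intro u hu
    have hu' : |u| ≤ T := abs_le.2 ⟨hu.1.le, hu.2⟩
    rw [norm_smul, Real.norm_of_nonneg (gaussDensity_nonneg α u)]
    refine mul_le_mul_of_nonneg_left ?_ (gaussDensity_nonneg α u)
    have h2 : ‖∫ r in (0 : ℝ)..u, c r‖ ≤ M * |u - 0| := by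
      refine intervalIntegral.norm_integral_le_of_norm_le_const fun r hr => hb r ?_
      rcases le_total 0 u with h | h
      · rw [uIoc_of_le h] at hr
        rw [abs_of_pos hr.1]
        exact hr.2.trans hu.2
      · rw [uIoc_of_ge h] at hr
        rw [abs_of_nonpos hr.2]
        linarith [hr.1, hu.1]
    rw [sub_zero] at h2
    nlinarith
  have h3 : ‖gaussFilter α T c‖ ≤ ∫ u in -T..T, gaussDensity α u * (T * M) :=
    intervalIntegral.norm_integral_le_of_norm_le (by linarith)
      (Filter.Eventually.of_forall fun u hu => h1 u hu)
      (((continuous_gaussDensity α).mul continuous_const).intervalIntegrable _ _)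
  rw [intervalIntegral.integral_mul_const] at h3
  have h4 := integral_gaussDensity_interval_le hα hT
  have h5 : 0 ≤ T * M := by positivity
  nlinarith

lemma gaussFilter_sub {α T : ℝ} {c c' : ℝ → E} (hc : Continuous c) (hc' : Continuous c') :
    gaussFilter α T (fun r => c r - c' r) = gaussFilter α T c - gaussFilter α T c' := by
  unfold gaussFilter
  rw [← intervalIntegral.integral_sub (intervalIntegrable_filter hc)
    (intervalIntegrable_filter hc')]
  refine intervalIntegral.integral_congr fun u _ => ?_
  simp only
  rw [intervalIntegral.integral_sub (hc.intervalIntegrable _ _) (hc'.intervalIntegrable _ _),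
    smul_sub]

lemma map_gaussFilter [CompleteSpace E] {F : Type*} [NormedAddCommGroup F] [NormedSpace ℝ F] [CompleteSpace F]
    (φ : E →L[ℝ] F) {α T : ℝ} {c : ℝ → E} (hc : Continuous c) :
    φ (gaussFilter α T c) = gaussFilter α T (fun r => φ (c r)) := by
  unfold gaussFilter
  rw [← ContinuousLinearMap.intervalIntegral_comp_comm φ (intervalIntegrable_filter hc)]
  refine intervalIntegral.integral_congr fun u _ => ?_
  simp only
  rw [map_smul, ContinuousLinearMap.intervalIntegral_comp_comm φ (hc.intervalIntegrable _ _)]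

/-- On oscillations of frequency `|ν| ≥ g` the filter acts as multiplication by `i / ν`, up to an
exponentially small error. -/
lemma norm_I_mul_gaussFilter_exp_add_le {g T ν : ℝ} (hg : 0 < g) (hT : 0 < T) (hν : g ≤ |ν|) :
    ‖Complex.I * gaussFilter (g / (2 * T)) T (fun r : ℝ => Complex.exp (Complex.I * r * ν))
      + 1 / (ν : ℂ)‖ ≤ 3 * Real.exp (-(g * T / 2)) / g := by
  -- For this width the tail e^{-αT²} and the Fourier transform e^{-g²/(4α)} at the gap both equal
  -- e^{-gT/2}.
  set α := g / (2 * T) with hα_def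
  have hα : 0 < α := by positivity
  have hνpos : 0 < |ν| := hg.trans_le hν
  have hν0 : (ν : ℂ) ≠ 0 := by
    simpa using abs_pos.1 hνpos
  have hIν : Complex.I * (ν : ℂ) ≠ 0 := mul_ne_zero Complex.I_ne_zero hν0
  have prim : ∀ u : ℝ, ∫ r in (0 : ℝ)..u, Complex.exp (Complex.I * r * ν)
      = (Complex.exp (Complex.I * u * ν) - 1) / (Complex.I * ν) := by
    intro u
    have := integral_exp_mul_complex (a := 0) (b := u) hIν
    rw [show (fun r : ℝ => Complex.exp (Complex.I * r * ν))
      = fun r : ℝ => Complex.exp (Complex.I * ν * r) by funext r; ring_nf, this]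
    simp only [Complex.ofReal_zero, mul_zero, Complex.exp_zero]
    ring_nf
  set I1 := ∫ u in -T..T, (gaussDensity α u : ℂ) * Complex.exp (Complex.I * u * ν) with hI1
  set Z := ∫ u in -T..T, (gaussDensity α u : ℂ) with hZ
  have hcg : Continuous fun u : ℝ => (gaussDensity α u : ℂ) :=
    Complex.continuous_ofReal.comp (continuous_gaussDensity α)
  have hce : Continuous fun u : ℝ => Complex.exp (Complex.I * u * ν) := by fun_prop
  have e1 : gaussFilter α T (fun r : ℝ => Complex.exp (Complex.I * r * ν))
      = (I1 - Z) / (Complex.I * ν) := by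
    unfold gaussFilter
    simp only [prim]
    have hci : Continuous fun u : ℝ => (gaussDensity α u : ℂ) * Complex.exp (Complex.I * u * ν) :=
      hcg.mul hce
    rw [hI1, hZ, ← intervalIntegral.integral_sub (hci.intervalIntegrable _ _)
      (hcg.intervalIntegrable _ _), ← intervalIntegral.integral_div]
    refine intervalIntegral.integral_congr fun u _ => ?_
    simp only [Complex.real_smul]
    ring
  have e2 : Complex.I * ((I1 - Z) / (Complex.I * ν)) + 1 / (ν : ℂ) = (I1 + (1 - Z)) / ν := by
    have := Complex.I_ne_zero
    field_simp
    ring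
  have hnorm : ∀ u : ℝ, ‖(gaussDensity α u : ℂ) * Complex.exp (Complex.I * u * ν)‖
      = gaussDensity α u := by
    intro u
    rw [norm_mul, Complex.norm_real, Real.norm_of_nonneg (gaussDensity_nonneg α u),
      show Complex.I * (u : ℂ) * ν = ((u * ν : ℝ) : ℂ) * Complex.I by push_cast; ring,
      Complex.norm_exp_ofReal_mul_I, mul_one]
  have hαT : -α * T ^ 2 = -(g * T / 2) := by rw [hα_def]; field_simp
  have t1 : ‖(Real.exp (-ν ^ 2 / (4 * α)) : ℂ) - I1‖ ≤ Real.exp (-(g * T / 2)) := by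
    rw [← integral_gaussDensity_mul_exp hα, ← hαT]
    refine norm_integral_sub_truncated_le hα hT.le ?_ fun u => (hnorm u).le
    refine (integrable_gaussDensity hα).mono (hcg.mul hce).aestronglyMeasurable
      (Filter.Eventually.of_forall fun u => ?_)
    rw [hnorm, Real.norm_of_nonneg (gaussDensity_nonneg α u)]
  have t2 : ‖1 - Z‖ ≤ Real.exp (-(g * T / 2)) := by
    have hint : ∫ u : ℝ, (gaussDensity α u : ℂ) = 1 := by
      rw [integral_complex_ofReal, integral_gaussDensity hα, Complex.ofReal_one]
    rw [← hint, ← hαT]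
    exact norm_integral_sub_truncated_le hα hT.le (integrable_gaussDensity hα).ofReal fun u => by
      rw [Complex.norm_real, Real.norm_of_nonneg (gaussDensity_nonneg α u)]
  have t3 : ‖(Real.exp (-ν ^ 2 / (4 * α)) : ℂ)‖ ≤ Real.exp (-(g * T / 2)) := by
    rw [Complex.norm_real, Real.norm_of_nonneg (Real.exp_pos _).le]
    refine Real.exp_le_exp.2 ?_
    have h1 : g ^ 2 ≤ ν ^ 2 := by rw [← sq_abs ν]; gcongr
    have h2 : -ν ^ 2 / (4 * α) = -(ν ^ 2 * T / (2 * g)) := by rw [hα_def]; field_simp; ring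
    rw [h2, neg_le_neg_iff, le_div_iff₀ (by positivity)]
    nlinarith
  rw [e1, e2, norm_div, Complex.norm_real, Real.norm_eq_abs]
  -- Three equal errors: the Fourier transform of the Gaussian at ν, and the truncations of its
  -- Fourier integral and of its mass.
  have t4 : ‖I1 + (1 - Z)‖ ≤ 3 * Real.exp (-(g * T / 2)) := by
    have : I1 + (1 - Z) = (Real.exp (-ν ^ 2 / (4 * α)) : ℂ)
      - ((Real.exp (-ν ^ 2 / (4 * α)) : ℂ) - I1) + (1 - Z) := by ring
    rw [this]
    refine (norm_add_le _ _).trans ?_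
    have := norm_sub_le (Real.exp (-ν ^ 2 / (4 * α)) : ℂ) ((Real.exp (-ν ^ 2 / (4 * α)) : ℂ) - I1)
    linarith
  exact div_le_div₀ (by positivity) t4 hg hν

end Filter

/-! ### Generators of the transport -/

section Generator

variable {𝔄 : Type*} [CStarAlgebra 𝔄]

/-- Duhamel: e^{-irK} e^{irH} has derivative of norm ‖H - K‖. -/
lemma norm_evol_sub_evol_le {H K : 𝔄} (hH : IsSelfAdjoint H) (hK : IsSelfAdjoint K) (t : ℝ) :
    ‖evol H t - evol K t‖ ≤ ‖H - K‖ * |t| := by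
  have hd : ∀ r : ℝ, HasDerivAt (fun r => evol (-K) r * evol H r)
      (evol (-K) r * (Complex.I • (H - K)) * evol H r) r := by
    intro r
    refine ((hasDerivAt_evol (-K) r).mul (hasDerivAt_evol' H r)).congr_deriv ?_
    simp only [smul_sub, smul_neg, mul_sub, sub_mul, mul_neg, neg_mul, mul_assoc]
    abel
  have hb := Convex.norm_image_sub_le_of_norm_hasDerivWithin_le (s := univ) (C := ‖H - K‖)
    (fun r _ => (hd r).hasDerivWithinAt) (fun r _ => ?_) convex_univ (mem_univ (0 : ℝ)) (mem_univ t)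
  · have h1 : evol (-K) t * evol H t - evol (-K) 0 * evol H 0
        = evol (-K) t * (evol H t - evol K t) := by
      rw [mul_sub, evol_neg_mul_evol, evol_zero, evol_zero, mul_one]
    simpa only [h1, CStarRing.norm_mem_unitary_mul _ (evol_mem_unitary hK.neg t), sub_zero,
      Real.norm_eq_abs] using hb
  · rw [CStarRing.norm_mul_mem_unitary _ (evol_mem_unitary hH r),
      CStarRing.norm_mem_unitary_mul _ (evol_mem_unitary hK.neg r), norm_smul, Complex.norm_I,
      one_mul]

/-- The filtered generator that transports the spectral subspaces of `H` in the direction `V`. -/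
def generator (α T : ℝ) (H V : 𝔄) : 𝔄 := Complex.I • gaussFilter α T (heis H V)

/-- The variant of the generator in which the evolution is generated by `H` on the left and by
`H'` on the right. -/
def mixedGenerator (α T : ℝ) (H H' : 𝔄) : 𝔄 :=
  Complex.I • gaussFilter α T (fun r => evol H r * (H' - H) * evol (-H') r)

lemma continuous_mixed (H H' : 𝔄) : Continuous fun r => evol H r * (H' - H) * evol (-H') r :=
  ((continuous_evol H).mul continuous_const).mul (continuous_evol (-H'))

lemma star_generator {α T : ℝ} {H V : 𝔄} (hH : IsSelfAdjoint H) (hV : IsSelfAdjoint V) :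
    star (generator α T H V) = -generator α T H V := by
  have h1 : star (gaussFilter α T (heis H V)) = gaussFilter α T (heis H V) := by
    have := map_gaussFilter (((starL' ℝ : 𝔄 ≃L[ℝ] 𝔄)) : 𝔄 →L[ℝ] 𝔄) (α := α) (T := T)
      (continuous_heis H V)
    have h2 : ∀ r, star (heis H V r) = heis H V r := fun r => heis_selfAdjoint hH hV r
    simpa [h2] using this
  rw [generator, star_smul, h1]
  simp

lemma norm_generator_le {α T : ℝ} (hα : 0 < α) (hT : 0 ≤ T) {H : 𝔄} (hH : IsSelfAdjoint H)
    (V : 𝔄) : ‖generator α T H V‖ ≤ T * ‖V‖ := by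
  rw [generator, norm_smul, Complex.norm_I, one_mul]
  exact norm_gaussFilter_le hα hT (norm_nonneg V) fun r _ => (norm_heis hH V r).le

/-- Star homomorphisms pass through exponentials and integrals. A generator formed inside K_l can
thus be studied in Λ while staying supported in K_l. -/
lemma map_generator {𝔅 : Type*} [CStarAlgebra 𝔅] (φ : 𝔄 →⋆ₐ[ℂ] 𝔅) (α T : ℝ) (H V : 𝔄) :
    φ (generator α T H V) = generator α T (φ H) (φ V) := by
  let _ : NormedAlgebra ℚ 𝔄 := .restrictScalars ℚ ℂ 𝔄
  let _ : NormedAlgebra ℚ 𝔅 := .restrictScalars ℚ ℂ 𝔅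
  have hφ : Continuous φ :=
    AddMonoidHomClass.continuous_of_bound φ 1 fun a => by
      simpa using NonUnitalStarAlgHom.norm_apply_le φ a
  let L : 𝔄 →L[ℂ] 𝔅 := ⟨φ.toAlgHom.toLinearMap, hφ⟩
  have hev : ∀ (K : 𝔄) (r : ℝ), φ (evol K r) = evol (φ K) r := by
    intro K r
    rw [evol, evol, NormedSpace.map_exp φ hφ]
    congr 1
    rw [← Complex.coe_smul, ← Complex.coe_smul, map_smul, map_smul]
  have hheis : ∀ r, φ (heis H V r) = heis (φ H) (φ V) r := by
    intro r
    rw [heis, heis, map_mul, map_mul, hev, hev, map_neg]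
  have := map_gaussFilter (L.restrictScalars ℝ) (α := α) (T := T) (continuous_heis H V)
  rw [generator, generator, map_smul]
  congr 1
  refine this.trans ?_
  congr 1
  funext r
  exact hheis r

/-- Comparison of the mixed generator with the generator built from another dynamics. -/
lemma norm_mixedGenerator_sub_generator_le {α T : ℝ} (hα : 0 < α) (hT : 0 ≤ T) {H H' K : 𝔄}
    (hH : IsSelfAdjoint H) (hH' : IsSelfAdjoint H') {b : ℝ} (hb0 : 0 ≤ b)
    (hb : ∀ r, |r| ≤ T → ‖heis H (H' - H) r - heis K (H' - H) r‖ ≤ b) :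
    ‖mixedGenerator α T H H' - generator α T K (H' - H)‖ ≤ T * (T * ‖H' - H‖ ^ 2 + b) := by
  rw [mixedGenerator, generator, ← smul_sub, norm_smul, Complex.norm_I, one_mul,
    ← gaussFilter_sub (continuous_mixed H H') (continuous_heis K _)]
  refine norm_gaussFilter_le hα hT (by positivity) fun r hr => ?_
  -- Replacing H' by H on the right is of second order in H' - H; replacing H by K afterwards is the
  -- assumed bound b.
  have h1 : evol H r * (H' - H) * evol (-H') r - heis K (H' - H) r
      = evol H r * ((H' - H) * (evol (-H') r - evol (-H) r))
        + (heis H (H' - H) r - heis K (H' - H) r) := by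
    rw [heis, heis]; noncomm_ring
  rw [h1]
  refine (norm_add_le _ _).trans (add_le_add ?_ (hb r hr))
  rw [CStarRing.norm_mem_unitary_mul _ (evol_mem_unitary hH r)]
  have h2 := norm_evol_sub_evol_le hH'.neg hH.neg r
  have h3 : -H' - -H = -(H' - H) := by abel
  rw [h3, norm_neg] at h2
  calc ‖(H' - H) * (evol (-H') r - evol (-H) r)‖
      ≤ ‖H' - H‖ * (‖H' - H‖ * |r|) :=
        (norm_mul_le _ _).trans (mul_le_mul_of_nonneg_left h2 (norm_nonneg _))
    _ ≤ ‖H' - H‖ * (‖H' - H‖ * T) := by gcongr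
    _ = T * ‖H' - H‖ ^ 2 := by ring

end Generator

/-! ### One transport step between nearby spectral subspaces -/

section Transport

variable {E : Type*} [NormedAddCommGroup E] [InnerProductSpace ℂ E] [FiniteDimensional ℂ E]

lemma evol_apply_eigenvector [CompleteSpace E] {H : E →L[ℂ] E} {e : E} {ev : ℝ}
    (he : H e = (ev : ℂ) • e) (t : ℝ) : evol H t e = Complex.exp (Complex.I * t * ev) • e := by
  have hd : ∀ r : ℝ, HasDerivAt
      (fun r : ℝ => Complex.exp (-(Complex.I * r * ev)) • evol H r e) 0 r := by
    intro r
    have h1 : HasDerivAt (fun r : ℝ => evol H r e) ((evol H r * (Complex.I • H)) e) r :=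
      ((ContinuousLinearMap.apply ℂ E e).restrictScalars ℝ).hasFDerivAt.comp_hasDerivAt r
        (hasDerivAt_evol H r)
    have h2 : HasDerivAt (fun r : ℝ => Complex.exp (-(Complex.I * r * ev)))
        (Complex.exp (-(Complex.I * r * ev)) * -(Complex.I * 1 * ev)) r :=
      (((((hasDerivAt_id (r : ℂ)).const_mul Complex.I).mul_const (ev : ℂ)).neg).cexp).comp_ofReal
    refine (h2.smul h1).congr_deriv ?_
    rw [mul_apply_eq_comp]
    simp only [smul_apply, he, map_smul, smul_smul, ← add_smul]
    ring_nf
    simp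
  have hc := is_const_of_deriv_eq_zero (fun r => (hd r).differentiableAt)
    (fun r => (hd r).deriv) t 0
  simp only [evol_zero, Complex.ofReal_zero, mul_zero, zero_mul, neg_zero, Complex.exp_zero,
    one_smul, one_apply_eq_self] at hc
  have h3 : Complex.exp (Complex.I * t * ev) * Complex.exp (-(Complex.I * t * ev)) = 1 := by
    rw [← Complex.exp_add, add_neg_cancel, Complex.exp_zero]
  calc evol H t e = (Complex.exp (Complex.I * t * ev) * Complex.exp (-(Complex.I * t * ev))) •
        evol H t e := by rw [h3, one_smul]
    _ = _ := by rw [mul_smul, hc]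

variable [CompleteSpace E]

lemma inner_evol_of_eigenvector {H : E →L[ℂ] E} (hH : IsSelfAdjoint H) {e : E} {ev : ℝ}
    (he : H e = (ev : ℂ) • e) (t : ℝ) (x : E) :
    inner ℂ e (evol H t x) = Complex.exp (Complex.I * t * ev) * inner ℂ e x := by
  have h1 : inner ℂ e (evol H t x) = inner ℂ (evol (-H) t e) x := by
    rw [← star_evol hH, ContinuousLinearMap.star_eq_adjoint,
      ContinuousLinearMap.adjoint_inner_left]
  have h2 : (-H) e = ((-ev : ℝ) : ℂ) • e := by simp [he]
  rw [h1, evol_apply_eigenvector h2, inner_smul_left, ← Complex.exp_conj]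
  congr 2
  simp

/-- The matrix elements of `1 - Y` between eigenvectors of `H` and of `H'` whose eigenvalues are
at distance at least `g`. -/
lemma norm_inner_sub_mixedGenerator_le {H H' : E →L[ℂ] E} (hH : IsSelfAdjoint H) {g T : ℝ} (hg : 0 < g)
    (hT : 0 < T) {e x : E} {ev ev' : ℝ} (he : H e = (ev : ℂ) • e) (hx : H' x = (ev' : ℂ) • x)
    (hgap : g ≤ |ev - ev'|) :
    ‖inner ℂ e (x - mixedGenerator (g / (2 * T)) T H H' x)‖
      ≤ 3 * Real.exp (-(g * T / 2)) / g * ‖inner ℂ e ((H' - H) x)‖ := by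
  set ν := ev - ev' with hν
  have hν0 : (ν : ℂ) ≠ 0 := by
    have : 0 < |ν| := hg.trans_le hgap
    simpa using abs_pos.1 this
  have hV : inner ℂ e ((H' - H) x) = -(ν : ℂ) * inner ℂ e x := by
    have h1 : inner ℂ e (H x) = inner ℂ (H e) x := by
      conv_rhs => rw [← hH.star_eq, ContinuousLinearMap.star_eq_adjoint,
        ContinuousLinearMap.adjoint_inner_left]
    rw [sub_apply, inner_sub_right, h1, he, hx, inner_smul_left,
      inner_smul_right, hν]
    simp
    ring
  have hx' : (-H') x = ((-ev' : ℝ) : ℂ) • x := by simp [hx]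
  -- With H on the left and H' on the right the matrix element oscillates at the single frequency ν,
  -- exactly. Hence the error is proportional to H' - H, with no second-order remainder.
  have hc : ∀ r : ℝ, inner ℂ e ((evol H r * (H' - H) * evol (-H') r) x)
      = Complex.exp (Complex.I * r * ν) * inner ℂ e ((H' - H) x) := by
    intro r
    rw [mul_apply_eq_comp, mul_apply_eq_comp, evol_apply_eigenvector hx', map_smul, map_smul, inner_smul_right,
      inner_evol_of_eigenvector hH he, ← mul_assoc, ← Complex.exp_add, hν]
    push_cast
    ring_nf
  let L : (E →L[ℂ] E) →L[ℂ] ℂ := (innerSL ℂ e).comp (ContinuousLinearMap.apply ℂ E x)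
  have hL : ∀ A : E →L[ℂ] E, L A = inner ℂ e (A x) := fun A => rfl
  let m : ℂ →L[ℂ] ℂ := ContinuousLinearMap.mul ℂ ℂ (inner ℂ e ((H' - H) x))
  have hY : inner ℂ e (mixedGenerator (g / (2 * T)) T H H' x) = inner ℂ e ((H' - H) x) *
      (Complex.I * gaussFilter (g / (2 * T)) T (fun r : ℝ => Complex.exp (Complex.I * r * ν))) := by
    have h1 := map_gaussFilter (L.restrictScalars ℝ) (α := g / (2 * T)) (T := T)
      (continuous_mixed H H')
    have h2 := map_gaussFilter (m.restrictScalars ℝ) (α := g / (2 * T)) (T := T)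
      (c := fun r : ℝ => Complex.exp (Complex.I * r * ν)) (by fun_prop)
    simp only [ContinuousLinearMap.coe_restrictScalars', hL, hc] at h1
    simp only [ContinuousLinearMap.coe_restrictScalars', m, ContinuousLinearMap.mul_apply'] at h2
    rw [mixedGenerator, smul_apply, inner_smul_right, h1, mul_left_comm, h2]
    simp only [mul_comm]
  have key : inner ℂ e (x - mixedGenerator (g / (2 * T)) T H H' x)
      = -((Complex.I * gaussFilter (g / (2 * T)) T (fun r : ℝ => Complex.exp (Complex.I * r * ν))
        + 1 / (ν : ℂ)) * inner ℂ e ((H' - H) x)) := by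
    rw [inner_sub_right, hY, hV]
    field_simp
    ring
  rw [key, norm_neg, norm_mul]
  exact mul_le_mul_of_nonneg_right (norm_I_mul_gaussFilter_exp_add_le hg hT hgap) (norm_nonneg _)

/-- If every eigenvector of the self-adjoint operator `H` lies in `M` or is orthogonal to `M`, then
the components of a vector orthogonal to `M` can be estimated eigenvector by eigenvector. -/
lemma norm_sub_starProjection_le {H : E →L[ℂ] E} (hH : IsSelfAdjoint H) (M : Submodule ℂ E)
    {ε : ℝ} (hε : 0 ≤ ε) {x y : E}
    (h : ∀ (e : E) (ev : ℝ), e ≠ 0 → H e = (ev : ℂ) • e →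
      e ∈ M ∨ (e ∈ Mᗮ ∧ ‖inner ℂ e x‖ ≤ ε * ‖inner ℂ e y‖)) :
    ‖x - M.starProjection x‖ ≤ ε * ‖y‖ := by
  have hsym : (H : E →ₗ[ℂ] E).IsSymmetric := hH.isSymmetric
  -- Parseval in an eigenbasis of H keeps the estimate free of the dimension of E, which grows with
  -- the volume.
  set b := hsym.eigenvectorBasis rfl with hb
  refine le_of_sq_le_sq ?_ (by positivity)
  rw [mul_pow, ← b.sum_sq_norm_inner_right, ← b.sum_sq_norm_inner_right y, Finset.mul_sum]
  refine Finset.sum_le_sum fun a _ => ?_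
  rw [← mul_pow]
  have hmem : x - M.starProjection x ∈ Mᗮ := M.sub_starProjection_mem_orthogonal x
  have hea : H (b a) = ((hsym.eigenvalues rfl a : ℝ) : ℂ) • b a := by
    have := hsym.apply_eigenvectorBasis rfl a
    exact this
  rcases h (b a) _ (b.orthonormal.ne_zero a) hea with h1 | ⟨h1, h2⟩
  · rw [Submodule.inner_right_of_mem_orthogonal h1 hmem, norm_zero, zero_pow two_ne_zero]
    positivity
  · have h3 : inner ℂ (b a) (M.starProjection x) = (0 : ℂ) :=
      Submodule.inner_left_of_mem_orthogonal (M.starProjection_apply_mem x) h1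
    rw [inner_sub_right, h3, sub_zero]
    gcongr

lemma norm_add_skew_sq {Y : E →L[ℂ] E} (hY : star Y = -Y) (x : E) :
    ‖x + Y x‖ ^ 2 = ‖x‖ ^ 2 + ‖Y x‖ ^ 2 := by
  have h1 : inner ℂ (Y x) x = -inner ℂ x (Y x) := by
    have : inner ℂ (Y x) x = inner ℂ x ((star Y) x) := by
      rw [ContinuousLinearMap.star_eq_adjoint, ContinuousLinearMap.adjoint_inner_right]
    rw [this, hY]
    simp
  have h2 : RCLike.re (inner ℂ x (Y x)) = 0 := by
    have h3 := inner_re_symm (𝕜 := ℂ) x (Y x)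
    rw [h1, map_neg] at h3
    linarith
  rw [norm_add_sq (𝕜 := ℂ), h2]
  ring

/-- Skewness kills the cross term, so the growth is of second order in y. A product of m such
factors with y of order 1/m stays bounded. -/
lemma norm_add_skew_le {Y : E →L[ℂ] E} (hY : star Y = -Y) {y : ℝ} (hy : ‖Y‖ ≤ y) (x : E) :
    ‖x + Y x‖ ≤ Real.exp (y ^ 2) * ‖x‖ := by
  refine le_of_sq_le_sq ?_ (by positivity)
  have h1 : ‖Y x‖ ≤ y * ‖x‖ := Y.le_of_opNorm_le hy x
  have h2 : ‖Y x‖ ^ 2 ≤ (y * ‖x‖) ^ 2 := by gcongr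
  have h3 : 1 + y ^ 2 ≤ Real.exp (y ^ 2) := by linarith [Real.add_one_le_exp (y ^ 2)]
  have h4 : Real.exp (y ^ 2) ≤ Real.exp (y ^ 2) ^ 2 := by
    have := Real.one_le_exp (sq_nonneg y)
    nlinarith
  rw [norm_add_skew_sq hY]
  calc ‖x‖ ^ 2 + ‖Y x‖ ^ 2 ≤ (1 + y ^ 2) * ‖x‖ ^ 2 := by nlinarith
    _ ≤ Real.exp (y ^ 2) ^ 2 * ‖x‖ ^ 2 := by gcongr; linarith
    _ = _ := by ring

/-- One step of the transport: `1 + Y` maps the spectral subspace `M` of `H` approximately onto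
the spectral subspace of `H'` spanned by the eigenvectors `ψ'`. -/
lemma exists_transport_step {D : ℕ} {H H' Y : E →L[ℂ] E} (hH : IsSelfAdjoint H) {g T : ℝ}
    (hg : 0 < g) (hT : 0 < T) {M : Submodule ℂ E} {ψ' : Fin D → E} (hψ' : Orthonormal ℂ ψ')
    {ev' : Fin D → ℝ} (hev' : ∀ b, H' (ψ' b) = (ev' b : ℂ) • ψ' b)
    (hsplit : ∀ (e : E) (ev : ℝ), e ≠ 0 → H e = (ev : ℂ) • e →
      e ∈ M ∨ (e ∈ Mᗮ ∧ ∀ b, g ≤ |ev - ev' b|))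
    (hY : star Y = -Y) {y δ : ℝ} (hy : ‖Y‖ ≤ y)
    (hδ : ‖mixedGenerator (g / (2 * T)) T H H' - Y‖ ≤ δ) {φ' : E}
    (hφ' : φ' ∈ Submodule.span ℂ (range ψ')) :
    ∃ φ ∈ M, ‖φ‖ ≤ Real.exp (y ^ 2) * ‖φ'‖ ∧
      ‖φ' - (φ + Y φ)‖ ≤ (y ^ 2 + Real.exp (y ^ 2) *
        (D * (3 * Real.exp (-(g * T / 2)) / g * ‖H' - H‖) + δ)) * ‖φ'‖ := by
  set Ym := mixedGenerator (g / (2 * T)) T H H' with hYm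
  set ε := 3 * Real.exp (-(g * T / 2)) / g with hε
  have hε0 : 0 ≤ ε := by positivity
  have hy0 : 0 ≤ y := (norm_nonneg _).trans hy
  have hYn : star (-Y) = -(-Y) := by rw [star_neg, hY]
  let Q : E →L[ℂ] E := 1 - M.starProjection
  have hQ : ∀ x, Q x = x - M.starProjection x := fun x => rfl
  have hQn : ∀ x, ‖Q x‖ ≤ ‖x‖ := by
    intro x
    rw [hQ, ← Submodule.starProjection_orthogonal_val]
    exact Mᗮ.norm_starProjection_apply_le x
  have hb : ∀ b, ‖Q (ψ' b - Ym (ψ' b))‖ ≤ ε * ‖H' - H‖ := by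
    intro b
    rw [hQ]
    refine (norm_sub_starProjection_le hH M hε0 (y := (H' - H) (ψ' b)) fun e ev he0 he => ?_).trans
      (mul_le_mul_of_nonneg_left ?_ hε0)
    · rcases hsplit e ev he0 he with h1 | ⟨h1, h2⟩
      · exact Or.inl h1
      · exact Or.inr ⟨h1, norm_inner_sub_mixedGenerator_le hH hg hT he (hev' b) (h2 b)⟩
    · have := (H' - H).le_opNorm (ψ' b)
      rwa [hψ'.1 b, mul_one] at this
  -- The filter estimate concerns single eigenvectors of H'; expanding φ' in them costs the factor
  -- D.
  have hm : ‖Q (φ' - Ym φ')‖ ≤ D * (ε * ‖H' - H‖) * ‖φ'‖ := by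
    obtain ⟨c, hc⟩ := (Submodule.mem_span_range_iff_exists_fun ℂ).1 hφ'
    have hcn : ∀ b, ‖c b‖ ≤ ‖φ'‖ := by
      intro b
      have h1 : inner ℂ (ψ' b) φ' = c b := by rw [← hc, hψ'.inner_right_fintype]
      rw [← h1]
      have := norm_inner_le_norm (𝕜 := ℂ) (ψ' b) φ'
      rwa [hψ'.1 b, one_mul] at this
    have h2 : Q (φ' - Ym φ') = ∑ b, c b • Q (ψ' b - Ym (ψ' b)) := by
      rw [← hc]
      simp only [map_sum, map_smul, map_sub, smul_sub, Finset.sum_sub_distrib]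
    rw [h2]
    calc ‖∑ b, c b • Q (ψ' b - Ym (ψ' b))‖ ≤ ∑ _b : Fin D, ‖φ'‖ * (ε * ‖H' - H‖) := by
          refine norm_sum_le_of_le _ fun b _ => ?_
          rw [norm_smul]
          exact mul_le_mul (hcn b) (hb b) (norm_nonneg _) (norm_nonneg _)
      _ = _ := by simp; ring
  set r := Q (φ' - Y φ') with hr
  have hrn : ‖r‖ ≤ (D * (ε * ‖H' - H‖) + δ) * ‖φ'‖ := by
    have h1 : r = Q (φ' - Ym φ') + Q ((Ym - Y) φ') := by
      have h2 : φ' - Y φ' = (φ' - Ym φ') + (Ym - Y) φ' := by rw [sub_apply]; abel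
      rw [hr, h2, map_add]
    rw [h1, add_mul]
    exact (norm_add_le _ _).trans
      (add_le_add hm ((hQn _).trans ((Ym - Y).le_of_opNorm_le hδ φ')))
  refine ⟨M.starProjection (φ' - Y φ'), M.starProjection_apply_mem _, ?_, ?_⟩
  · refine (M.norm_starProjection_apply_le _).trans ?_
    simpa [sub_eq_add_neg] using norm_add_skew_le hYn (by rwa [norm_neg]) φ'
  · have h1 : M.starProjection (φ' - Y φ') = φ' - Y φ' - r := by rw [hr, hQ]; abel
    -- This is (1 + Y)(1 - Y) = 1 - Y², with r the part of (1 - Y)φ' that misses M.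
    have h2 : φ' - (M.starProjection (φ' - Y φ') + Y (M.starProjection (φ' - Y φ')))
        = Y (Y φ') + (r + Y r) := by
      rw [h1]
      simp only [map_sub]
      abel
    rw [h2, add_mul]
    refine (norm_add_le _ _).trans (add_le_add ?_ ?_)
    · calc ‖Y (Y φ')‖ ≤ y * (y * ‖φ'‖) :=
            (Y.le_of_opNorm_le hy _).trans (mul_le_mul_of_nonneg_left (Y.le_of_opNorm_le hy _) hy0)
        _ = _ := by ring
    · refine (norm_add_skew_le hY hy r).trans ?_
      rw [mul_assoc]
      gcongr

end Transport

/-! ### The spectral sector: uniform gap and composition of steps -/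

section Sector

variable {Γ : Type u} [DecidableEq Γ] {n : Γ → ℕ} {Λ : Finset Γ}

lemma mem_spectrum_of_eigenvector {H : Op n Λ} {x : Hilb n Λ} (hx : x ≠ 0) {r : ℝ}
    (h : H x = (r : ℂ) • x) : r ∈ spectrum ℝ H := by
  rw [spectrum.mem_iff]
  rintro ⟨w, hw⟩
  apply hx
  have h1 : (w : Op n Λ) x = 0 := by
    rw [hw, sub_apply, h, Algebra.algebraMap_eq_smul_one, smul_apply,
      one_apply_eq_self, Complex.coe_smul, sub_self]
  have h2 : ((↑w⁻¹ : Op n Λ) * (w : Op n Λ)) x = x := by rw [w.inv_mul, one_apply_eq_self]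
  rw [← h2, mul_apply_eq_comp, h1, map_zero]

lemma inner_eq_zero_of_eigenvectors {H : Op n Λ} (hH : IsSelfAdjoint H) {x y : Hilb n Λ} {r r' : ℝ}
    (hx : H x = (r : ℂ) • x) (hy : H y = (r' : ℂ) • y) (hne : r ≠ r') :
    inner ℂ x y = (0 : ℂ) := by
  have h1 : inner ℂ (H x) y = inner ℂ x (H y) := by
    conv_lhs => rw [← hH.star_eq, ContinuousLinearMap.star_eq_adjoint,
      ContinuousLinearMap.adjoint_inner_left]
  rw [hx, hy, inner_smul_left, inner_smul_right, Complex.conj_ofReal] at h1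
  have h2 : ((r : ℂ) - r') * inner ℂ x y = 0 := by rw [sub_mul, h1, sub_self]
  refine (mul_eq_zero.1 h2).resolve_left fun h3 => hne ?_
  exact_mod_cast sub_eq_zero.1 h3

lemma mem_sectorSpace {H : Op n Λ} {S : Set ℝ} {x : Hilb n Λ} {r : ℝ} (hr : r ∈ S)
    (h : H x = (r : ℂ) • x) : x ∈ sectorSpace H S :=
  Submodule.mem_iSup_of_mem r (Submodule.mem_iSup_of_mem hr (Module.End.mem_eigenspace_iff.2 h))

lemma IsEigenbasisIn.span_eq {D : ℕ} {H : Op n Λ} {S : Set ℝ} {ψ : Fin D → Hilb n Λ}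
    (h : IsEigenbasisIn H S ψ) (hD : Module.finrank ℂ (sectorSpace H S) = D) :
    Submodule.span ℂ (range ψ) = sectorSpace H S := by
  obtain ⟨ho, ev, hev⟩ := h
  refine Submodule.eq_of_le_of_finrank_eq ?_ ?_
  · rw [Submodule.span_le]
    rintro _ ⟨i, rfl⟩
    exact mem_sectorSpace (hev i).1 (hev i).2
  · rw [hD, finrank_span_eq_card ho.linearIndependent, Fintype.card_fin]

/-- In the limit, eigenvalues from the sector stay in the sector. -/
lemma IsGappedSector.mem_of_tendsto {D : ℕ} {H : ℝ → Op n Λ} {σin σout : ℝ → Set ℝ} {g L : ℝ}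
    (hgap : IsGappedSector H σin σout g L D) {s : ℕ → ℝ} (hs : ∀ k, s k ∈ Icc (0 : ℝ) 1) {s₀ : ℝ}
    (hs₀ : s₀ ∈ Icc (0 : ℝ) 1) (hlim : Filter.Tendsto s Filter.atTop (nhds s₀)) {r : ℕ → ℝ}
    (hr : ∀ k, r k ∈ σin (s k)) {r₀ : ℝ} (hrlim : Filter.Tendsto r Filter.atTop (nhds r₀))
    (hr₀ : r₀ ∈ spectrum ℝ (H s₀)) : r₀ ∈ σin s₀ := by
  obtain ⟨a, b, ha, hb, hab⟩ := hgap.interval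
  have hw : Filter.Tendsto s Filter.atTop (nhdsWithin s₀ (Icc 0 1)) :=
    tendsto_nhdsWithin_iff.2 ⟨hlim, Filter.Eventually.of_forall hs⟩
  have h1 : a s₀ ≤ r₀ := le_of_tendsto_of_tendsto' ((ha s₀ hs₀).tendsto.comp hw) hrlim
    fun k => ((hab _ (hs k)).2.2.1 (hr k)).1
  have h2 : r₀ ≤ b s₀ := le_of_tendsto_of_tendsto' hrlim ((hb s₀ hs₀).tendsto.comp hw)
    fun k => ((hab _ (hs k)).2.2.1 (hr k)).2
  rw [hgap.spectrum_eq s₀ hs₀] at hr₀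
  exact hr₀.resolve_right fun h3 => Set.disjoint_left.1 (hab s₀ hs₀).2.2.2 ⟨h1, h2⟩ h3

/-- The gap between the sector at `s'` and the rest of the spectrum at `s`, for `s'` near `s`,
uniformly on `[0, 1]`. -/
lemma IsGappedSector.exists_uniform_gap {D : ℕ} {H : ℝ → Op n Λ} {σin σout : ℝ → Set ℝ} {g L : ℝ}
    (hgap : IsGappedSector H σin σout g L D) (hg : 0 < g) (hcont : ContinuousOn H (Icc 0 1))
    (hsa : ∀ s ∈ Icc (0 : ℝ) 1, IsSelfAdjoint (H s)) {ψ : ℝ → Fin D → Hilb n Λ}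
    (hψ : ∀ s ∈ Icc (0 : ℝ) 1, IsEigenbasisIn (H s) (σin s) (ψ s)) {g' : ℝ} (hg' : g' < g) :
    ∃ δ > 0, ∀ s ∈ Icc (0 : ℝ) 1, ∀ s' ∈ Icc (0 : ℝ) 1, |s - s'| < δ →
      ∀ (x x' : Hilb n Λ) (r r' : ℝ), ‖x‖ = 1 → ‖x'‖ = 1 → H s x = (r : ℂ) • x →
        H s' x' = (r' : ℂ) • x' → r ∈ σout s → r' ∈ σin s' → g' ≤ |r - r'| := by
  by_contra hcon
  push Not at hcon
  have hpos : ∀ k : ℕ, (0 : ℝ) < 1 / (k + 1) := fun k => by positivity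
  choose s hs s' hs' hss x x' r r' hx hx' hHx hHx' hr hr' hlt using fun k : ℕ => hcon _ (hpos k)
  choose w hw using fun k => (hψ (s k) (hs k)).2
  obtain ⟨C, hC⟩ := isCompact_Icc.exists_bound_of_continuousOn hcont
  have hevb : ∀ t ∈ Icc (0 : ℝ) 1, ∀ (z : Hilb n Λ) (c : ℝ), ‖z‖ = 1 → H t z = (c : ℂ) • z →
      |c| ≤ C := by
    intro t ht z c hz h1
    have h2 := (H t).le_opNorm z
    rw [h1, norm_smul, hz, mul_one, mul_one, Complex.norm_real, Real.norm_eq_abs] at h2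
    exact h2.trans (hC t ht)
  -- C bounds the eigenvalues; 1 bounds the parameters and the unit vectors.
  set R := max 1 C with hR
  have hC0 : 0 ≤ R := zero_le_one.trans (le_max_left _ _)
  -- The eigenbases need not depend continuously on s, so a whole basis with its eigenvalues goes
  -- into the compactness argument.
  let ζ : ℕ → ℝ × ℝ × ℝ × ℝ × Hilb n Λ × Hilb n Λ × (Fin D → Hilb n Λ) × (Fin D → ℝ) :=
    fun k => (s k, s' k, r k, r' k, x k, x' k, ψ (s k), w k)
  have hψn : ∀ k i, ‖ψ (s k) i‖ = 1 := fun k i => (hψ (s k) (hs k)).1.1 i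
  have hζ : ∀ k, ζ k ∈ Metric.closedBall 0 R := by
    intro k
    rw [mem_closedBall_zero_iff]
    simp only [ζ, Prod.norm_def, sup_le_iff, Real.norm_eq_abs, pi_norm_le_iff_of_nonneg hC0]
    have h1 : (1 : ℝ) ≤ R := le_max_left _ _
    have h2 : C ≤ R := le_max_right _ _
    refine ⟨?_, ?_, (hevb _ (hs k) _ _ (hx k) (hHx k)).trans h2,
      (hevb _ (hs' k) _ _ (hx' k) (hHx' k)).trans h2, (hx k).le.trans h1, (hx' k).le.trans h1,
      fun i => (hψn k i).le.trans h1,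
      fun i => (hevb _ (hs k) _ _ (hψn k i) (hw k i).2).trans h2⟩
    · exact (abs_le.2 ⟨by linarith [(hs k).1], (hs k).2⟩).trans h1
    · exact (abs_le.2 ⟨by linarith [(hs' k).1], (hs' k).2⟩).trans h1
  obtain ⟨⟨s₀, s₀', r₀, r₀', x₀, x₀', ψ₀, w₀⟩, -, θ, hθ, hlim⟩ :=
    tendsto_subseq_of_bounded Metric.isBounded_closedBall hζ
  simp only [nhds_prod_eq] at hlim
  have l1 : Filter.Tendsto (fun k => s (θ k)) Filter.atTop (nhds s₀) := hlim.fst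
  have l2 : Filter.Tendsto (fun k => s' (θ k)) Filter.atTop (nhds s₀') := hlim.snd.fst
  have l3 : Filter.Tendsto (fun k => r (θ k)) Filter.atTop (nhds r₀) := hlim.snd.snd.fst
  have l4 : Filter.Tendsto (fun k => r' (θ k)) Filter.atTop (nhds r₀') := hlim.snd.snd.snd.fst
  have l5 : Filter.Tendsto (fun k => x (θ k)) Filter.atTop (nhds x₀) := hlim.snd.snd.snd.snd.fst
  have l6 : Filter.Tendsto (fun k => x' (θ k)) Filter.atTop (nhds x₀') :=
    hlim.snd.snd.snd.snd.snd.fst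
  have l7' : Filter.Tendsto (fun k => ψ (s (θ k))) Filter.atTop (nhds ψ₀) :=
    hlim.snd.snd.snd.snd.snd.snd.fst
  have l8' : Filter.Tendsto (fun k => w (θ k)) Filter.atTop (nhds w₀) :=
    hlim.snd.snd.snd.snd.snd.snd.snd
  have l7 := tendsto_pi_nhds.1 l7'
  have l8 := tendsto_pi_nhds.1 l8'
  have hs₀ : s₀ ∈ Icc (0 : ℝ) 1 :=
    isClosed_Icc.mem_of_tendsto l1 (Filter.Eventually.of_forall fun k => hs _)
  have heq : s₀' = s₀ := by
    have h1 : Filter.Tendsto (fun k => |s (θ k) - s' (θ k)|) Filter.atTop (nhds 0) := by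
      refine squeeze_zero (fun _ => abs_nonneg _) (fun k => (hss (θ k)).le) ?_
      exact tendsto_one_div_add_atTop_nhds_zero_nat.comp hθ.tendsto_atTop
    have h2 := tendsto_nhds_unique ((l1.sub l2).abs) h1
    linarith [abs_eq_zero.1 h2]
  rw [heq] at l2
  have hH : ∀ t : ℕ → ℝ, (∀ k, t k ∈ Icc (0 : ℝ) 1) →
      Filter.Tendsto t Filter.atTop (nhds s₀) →
      Filter.Tendsto (fun k => H (t k)) Filter.atTop (nhds (H s₀)) := fun t ht hl =>
    (hcont s₀ hs₀).tendsto.comp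
      (tendsto_nhdsWithin_iff.2 ⟨hl, Filter.Eventually.of_forall ht⟩)
  have heig : ∀ (t : ℕ → ℝ) (z : ℕ → Hilb n Λ) (c : ℕ → ℝ) (z₀ : Hilb n Λ) (c₀ : ℝ),
      (∀ k, t k ∈ Icc (0 : ℝ) 1) → Filter.Tendsto t Filter.atTop (nhds s₀) →
      Filter.Tendsto z Filter.atTop (nhds z₀) → Filter.Tendsto c Filter.atTop (nhds c₀) →
      (∀ k, H (t k) (z k) = (c k : ℂ) • z k) → H s₀ z₀ = (c₀ : ℂ) • z₀ := by
    intro t z c z₀ c₀ ht h1 h2 h3 h4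
    have h5 : Filter.Tendsto (fun k => H (t k) (z k)) Filter.atTop (nhds (H s₀ z₀)) :=
      (isBoundedBilinearMap_apply.continuous.tendsto (H s₀, z₀)).comp
        ((hH t ht h1).prodMk_nhds h2)
    have h6 := ((Complex.continuous_ofReal.tendsto c₀).comp h3).smul h2
    refine tendsto_nhds_unique h5 (h6.congr fun k => ?_)
    exact (h4 k).symm
  have hnorm : ∀ (z : ℕ → Hilb n Λ) (z₀ : Hilb n Λ), Filter.Tendsto z Filter.atTop (nhds z₀) →
      (∀ k, ‖z k‖ = 1) → ‖z₀‖ = 1 := fun z z₀ h1 h2 =>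
    tendsto_nhds_unique h1.norm (by simp [h2])
  have nz : ∀ z : Hilb n Λ, ‖z‖ = 1 → z ≠ 0 := fun z hz => by
    rw [← norm_ne_zero_iff, hz]; exact one_ne_zero
  have hx₀ := hnorm _ _ l5 fun k => hx _
  have hx₀' := hnorm _ _ l6 fun k => hx' _
  have ex := heig _ _ _ _ _ (fun k => hs _) l1 l5 l3 fun k => hHx _
  have ex' := heig _ _ _ _ _ (fun k => hs' _) l2 l6 l4 fun k => hHx' _
  have eψ := fun i => heig _ _ _ _ _ (fun k => hs _) l1 (l7 i) (l8 i) fun k => (hw _ i).2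
  have hr₀' : r₀' ∈ σin s₀ := hgap.mem_of_tendsto (fun k => hs' _) hs₀ l2 (fun k => hr' _) l4
    (mem_spectrum_of_eigenvector (nz _ hx₀') ex')
  have hψ₀n := fun i => hnorm _ _ (l7 i) fun k => hψn _ i
  have hw₀ : ∀ i, w₀ i ∈ σin s₀ := fun i =>
    hgap.mem_of_tendsto (fun k => hs _) hs₀ l1 (fun k => (hw _ i).1) (l8 i)
      (mem_spectrum_of_eigenvector (nz _ (hψ₀n i)) (eψ i))
  -- The limit of outer eigenvalues is within g' < g of a sector eigenvalue, so the gap at s₀ forces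
  -- it into the sector.
  have hr₀ : r₀ ∈ σin s₀ := by
    have h1 : r₀ ∈ spectrum ℝ (H s₀) := mem_spectrum_of_eigenvector (nz _ hx₀) ex
    rw [hgap.spectrum_eq s₀ hs₀] at h1
    refine h1.resolve_right fun h2 => ?_
    have h3 := hgap.gap s₀ hs₀ _ hr₀' _ h2
    have h4 : |r₀ - r₀'| ≤ g' := le_of_tendsto' (l3.sub l4).abs fun k => (hlt _).le
    rw [abs_sub_comm] at h4
    linarith
  have ho : Orthonormal ℂ ψ₀ := by
    refine ⟨hψ₀n, fun i j hij => ?_⟩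
    refine tendsto_nhds_unique ((l7 i).inner (l7 j)) ?_
    have h1 : ∀ k, inner ℂ (ψ (s (θ k)) i) (ψ (s (θ k)) j) = (0 : ℂ) :=
      fun k => (hψ _ (hs _)).1.2 hij
    simp [h1]
  have horth : ∀ i, inner ℂ (ψ₀ i) x₀ = (0 : ℂ) := by
    intro i
    refine tendsto_nhds_unique ((l7 i).inner l5) ?_
    have h1 : ∀ k, inner ℂ (ψ (s (θ k)) i) (x (θ k)) = (0 : ℂ) := by
      intro k
      refine inner_eq_zero_of_eigenvectors (hsa _ (hs _)) (hw _ i).2 (hHx _) fun h2 => ?_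
      have h3 := hgap.gap _ (hs _) _ (hw (θ k) i).1 _ (hr (θ k))
      rw [h2, sub_self, abs_zero] at h3
      linarith
    simp [h1]
  have hbasis : IsEigenbasisIn (H s₀) (σin s₀) ψ₀ := ⟨ho, w₀, fun i => ⟨hw₀ i, eψ i⟩⟩
  -- The limit basis already fills the D-dimensional sector, yet x₀ is a unit vector of the sector
  -- orthogonal to it. Constancy of the dimension is what excludes outer eigenvalues from merging
  -- into the sector.
  have hmem : x₀ ∈ Submodule.span ℂ (range ψ₀) := by
    rw [hbasis.span_eq (hgap.dim s₀ hs₀)]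
    exact mem_sectorSpace hr₀ ex
  obtain ⟨c, hc⟩ := (Submodule.mem_span_range_iff_exists_fun ℂ).1 hmem
  have hself : inner ℂ x₀ x₀ = (0 : ℂ) := by
    conv_lhs => rw [← hc]
    rw [sum_inner]
    refine Finset.sum_eq_zero fun i _ => ?_
    rw [inner_smul_left, hc, horth i, mul_zero]
  exact nz _ hx₀ (inner_self_eq_zero.1 hself)

/-- Eigenvectors at `s` lie in the sector, or are orthogonal to it and separated by `g'` from the
sector at nearby `s'`. -/
lemma IsGappedSector.exists_uniform_split {D : ℕ} {H : ℝ → Op n Λ} {σin σout : ℝ → Set ℝ} {g L : ℝ}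
    (hgap : IsGappedSector H σin σout g L D) (hg : 0 < g) (hcont : ContinuousOn H (Icc 0 1))
    (hsa : ∀ s ∈ Icc (0 : ℝ) 1, IsSelfAdjoint (H s)) {ψ : ℝ → Fin D → Hilb n Λ}
    (hψ : ∀ s ∈ Icc (0 : ℝ) 1, IsEigenbasisIn (H s) (σin s) (ψ s)) {g' : ℝ} (hg' : g' < g) :
    ∃ δ > 0, ∀ s ∈ Icc (0 : ℝ) 1, ∀ s' ∈ Icc (0 : ℝ) 1, |s - s'| < δ →
      ∃ ev' : Fin D → ℝ, (∀ b, H s' (ψ s' b) = (ev' b : ℂ) • ψ s' b) ∧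
        ∀ (e : Hilb n Λ) (ev : ℝ), e ≠ 0 → H s e = (ev : ℂ) • e →
          e ∈ Submodule.span ℂ (range (ψ s)) ∨
            (e ∈ (Submodule.span ℂ (range (ψ s)))ᗮ ∧ ∀ b, g' ≤ |ev - ev' b|) := by
  obtain ⟨δ, hδ, h⟩ := hgap.exists_uniform_gap hg hcont hsa hψ hg'
  refine ⟨δ, hδ, fun s hs s' hs' hss => ?_⟩
  obtain ⟨ev', hev'⟩ := (hψ s' hs').2
  refine ⟨ev', fun b => (hev' b).2, fun e ev he hee => ?_⟩
  have h1 := mem_spectrum_of_eigenvector he hee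
  rw [hgap.spectrum_eq s hs] at h1
  rcases h1 with h1 | h1
  · left
    rw [(hψ s hs).span_eq (hgap.dim s hs)]
    exact mem_sectorSpace h1 hee
  · right
    constructor
    · obtain ⟨ev₀, hev₀⟩ := (hψ s hs).2
      rw [Submodule.mem_orthogonal]
      intro z hz
      induction hz using Submodule.span_induction with
      | mem z hz =>
        obtain ⟨i, rfl⟩ := hz
        refine inner_eq_zero_of_eigenvectors (hsa s hs) (hev₀ i).2 hee fun h2 => ?_
        have h3 := hgap.gap s hs _ (hev₀ i).1 _ h1
        rw [h2, sub_self, abs_zero] at h3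
        linarith
      | zero => simp
      | add x y _ _ hx hy => rw [inner_add_left, hx, hy, add_zero]
      | smul c x _ hx => rw [inner_smul_left, hx, mul_zero]
    · intro b
      refine h s hs s' hs' hss ((‖e‖⁻¹ : ℂ) • e) (ψ s' b) ev (ev' b) ?_ ((hψ s' hs').1.1 b) ?_
        (hev' b).2 h1 (hev' b).1
      · exact norm_smul_inv_norm he
      · rw [map_smul, hee, smul_comm]

/-- Composition of the transport steps. -/
lemma exists_transport {Ω : Finset Γ} (hΩ : Ω ⊆ Λ) {q e : ℝ} (hq : 1 ≤ q) (he : 0 ≤ e)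
    (M : ℕ → Submodule ℂ (Hilb n Λ)) (Y : ℕ → Op n Ω) {N : ℕ}
    (hY : ∀ k < N, ∀ x, ‖x + embed hΩ (Y k) x‖ ≤ q * ‖x‖)
    (hstep : ∀ k < N, ∀ φ' ∈ M (k + 1), ∃ φ ∈ M k, ‖φ‖ ≤ q * ‖φ'‖ ∧
      ‖φ' - (φ + embed hΩ (Y k) φ)‖ ≤ e * ‖φ'‖) :
    ∃ B : Op n Ω, (∀ x, ‖embed hΩ B x‖ ≤ q ^ N * ‖x‖) ∧
      ∀ φ' ∈ M N, ∃ φ ∈ M 0, ‖φ‖ ≤ q ^ N * ‖φ'‖ ∧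
        ‖φ' - embed hΩ B φ‖ ≤ q ^ (2 * N) * (N * e) * ‖φ'‖ := by
  induction N with
  | zero =>
    refine ⟨1, fun x => by simp [embed_one], fun φ' hφ' => ⟨φ', hφ', by simp, by simp [embed_one]⟩⟩
  | succ N ih =>
    obtain ⟨B, hB, hBM⟩ := ih (fun k hk => hY k (hk.trans N.lt_succ_self))
      (fun k hk => hstep k (hk.trans N.lt_succ_self))
    have hap : ∀ x, embed hΩ ((1 + Y N) * B) x
        = embed hΩ B x + embed hΩ (Y N) (embed hΩ B x) := by
      intro x
      rw [embed_mul, embed_add, embed_one, mul_apply_eq_comp]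
      simp
    have hq0 : 0 ≤ q := zero_le_one.trans hq
    refine ⟨(1 + Y N) * B, fun x => ?_, fun φ' hφ' => ?_⟩
    · rw [hap]
      refine (hY N N.lt_succ_self _).trans ?_
      calc q * ‖embed hΩ B x‖ ≤ q * (q ^ N * ‖x‖) := mul_le_mul_of_nonneg_left (hB x) hq0
        _ = _ := by ring
    · obtain ⟨φ₁, hφ₁, hn₁, hd₁⟩ := hstep N N.lt_succ_self φ' hφ'
      obtain ⟨φ, hφ, hn, hd⟩ := hBM φ₁ hφ₁
      refine ⟨φ, hφ, ?_, ?_⟩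
      · calc ‖φ‖ ≤ q ^ N * ‖φ₁‖ := hn
          _ ≤ q ^ N * (q * ‖φ'‖) := by gcongr
          _ = _ := by ring
      · have h1 : φ' - embed hΩ ((1 + Y N) * B) φ = (φ' - (φ₁ + embed hΩ (Y N) φ₁))
            + ((φ₁ - embed hΩ B φ) + embed hΩ (Y N) (φ₁ - embed hΩ B φ)) := by
          rw [hap, map_sub]
          abel
        rw [h1]
        have h2 : ‖φ₁ - embed hΩ B φ‖ ≤ q ^ (2 * N) * (N * e) * (q * ‖φ'‖) :=
          hd.trans (by gcongr)
        have h3 : e * ‖φ'‖ ≤ q ^ (2 * (N + 1)) * e * ‖φ'‖ := by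
          have : 1 ≤ q ^ (2 * (N + 1)) := one_le_pow₀ hq
          have h4 : 0 ≤ e * ‖φ'‖ := by positivity
          nlinarith
        -- An old error grows by q twice: through the factor 1 + Y, and through the norm of the
        -- vector pulled back by one step.
        calc _ ≤ e * ‖φ'‖ + q * (q ^ (2 * N) * (N * e) * (q * ‖φ'‖)) :=
              (norm_add_le _ _).trans (add_le_add hd₁
                ((hY N N.lt_succ_self _).trans (mul_le_mul_of_nonneg_left h2 hq0)))
          _ ≤ q ^ (2 * (N + 1)) * e * ‖φ'‖ + q * (q ^ (2 * N) * (N * e) * (q * ‖φ'‖)) := by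
              linarith
          _ = _ := by push_cast; ring

end Sector

/-! ### Local terms of the perturbed Hamiltonian -/

section LocalTerms

variable {Γ : Type u} [DecidableEq Γ] {n : Γ → ℕ}

lemma embed_self {X : Finset Γ} (h : X ⊆ X) (A : Op n X) : embed h A = A := by
  apply toMat_injective
  ext σ τ
  rw [toMat_embed, if_pos fun y hy => absurd y.2 hy]
  rfl

/-- The observables of `Y` that are supported in `X`, as a subalgebra. -/
def supportAlgebra {n : Γ → ℕ} {X Y : Finset Γ} (h : X ⊆ Y) : Subalgebra ℂ (Op n Y) :=
  (embedHom h).toAlgHom.range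

lemma embed_mem_supportAlgebra {X Y : Finset Γ} (h : X ⊆ Y) (A : Op n X) :
    embed h A ∈ supportAlgebra h := ⟨A, rfl⟩

lemma commute_of_mem_supportAlgebra {X Y Z : Finset Γ} {hX : X ⊆ Z} {hY : Y ⊆ Z}
    (hd : Disjoint X Y) {A B : Op n Z} (hA : A ∈ supportAlgebra hX) (hB : B ∈ supportAlgebra hY) :
    Commute A B := by
  obtain ⟨A, rfl⟩ := hA
  obtain ⟨B, rfl⟩ := hB
  exact embed_commute hX hY hd A B

lemma embed_selfAdjoint {X Y : Finset Γ} (h : X ⊆ Y) {A : Op n X} (hA : IsSelfAdjoint A) :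
    IsSelfAdjoint (embed h A) := by
  rw [IsSelfAdjoint, ← embed_star, hA.star_eq]

/-- The identification `A ↦ A ⊗ 1` as a continuous real-linear map. -/
def embedCLM {X Y : Finset Γ} (h : X ⊆ Y) : Op n X →L[ℝ] Op n Y where
  toLinearMap := (embedHom h).toAlgHom.toLinearMap.restrictScalars ℝ
  cont := AddMonoidHomClass.continuous_of_bound (embedHom h) 1 fun A => by
    rw [one_mul]; exact norm_embed_le h A

lemma perturbation_embed {K S Λ : Finset Γ} (hK : K ⊆ S) (hS : S ⊆ Λ)
    (W : (k : Γ) → ℝ → Op n {k}) (s : ℝ) :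
    embed hS (perturbation hK W s) = perturbation (hK.trans hS) W s := by
  unfold perturbation
  rw [← embedHom_apply, map_sum]
  refine Finset.sum_congr rfl fun k _ => ?_
  rw [embedHom_apply, embed_embed]

/-- The local term at `Z` of the Hamiltonian `H(s)` on `Λ`, the perturbation included. -/
def localTerm (Φ : Interaction n) {K Λ : Finset Γ} (hK : K ⊆ Λ) (W : (k : Γ) → ℝ → Op n {k})
    (s : ℝ) (Z : Finset Γ) : Op n Λ :=
  (if hZ : Z ⊆ Λ then embed hZ (Φ.term Z) else 0) + ∑ k ∈ K.attach,
    if Z = {(k : Γ)} then embed (Finset.singleton_subset_iff.2 (hK k.2)) (W k s) else 0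

variable {Φ : Interaction n} {K Λ : Finset Γ} {hK : K ⊆ Λ} {W : (k : Γ) → ℝ → Op n {k}}

lemma localSum_localTerm {S : Finset Γ} (hKS : K ⊆ S) (hS : S ⊆ Λ) (s : ℝ) :
    localSum (localTerm Φ hK W s) S = embed hS (hamiltonianPath Φ hKS W s) := by
  unfold localSum localTerm
  rw [Finset.sum_add_distrib, hamiltonianPath, embed_add, perturbation_embed hKS hS]
  congr 1
  · rw [← Finset.sum_attach, hamiltonian, ← embedHom_apply, map_sum]
    refine Finset.sum_congr rfl fun Z _ => ?_
    rw [dif_pos ((Finset.mem_powerset.1 Z.2).trans hS), embedHom_apply, embed_embed]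
  · rw [Finset.sum_comm, perturbation]
    refine Finset.sum_congr rfl fun k _ => ?_
    rw [Finset.sum_ite_eq', if_pos]
    exact Finset.mem_powerset.2 (Finset.singleton_subset_iff.2 (hKS k.2))

lemma localSum_localTerm_self (s : ℝ) :
    localSum (localTerm Φ hK W s) Λ = hamiltonianPath Φ hK W s := by
  rw [localSum_localTerm hK subset_rfl, embed_self]

lemma localTerm_mem_supportAlgebra (s : ℝ) {Z : Finset Γ} (hZ : Z ⊆ Λ) :
    localTerm Φ hK W s Z ∈ supportAlgebra hZ := by
  rw [localTerm, dif_pos hZ]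
  refine add_mem (embed_mem_supportAlgebra hZ _) (sum_mem fun k _ => ?_)
  split_ifs with h
  · subst h
    exact embed_mem_supportAlgebra hZ _
  · exact zero_mem _

lemma localTerm_selfAdjoint (hW : IsPerturbationPath K W) {s : ℝ} (hs : s ∈ Icc (0 : ℝ) 1)
    (Z : Finset Γ) : IsSelfAdjoint (localTerm Φ hK W s Z) := by
  unfold localTerm
  refine IsSelfAdjoint.add (R := Op n Λ) ?_ ?_
  · split_ifs with h
    · exact embed_selfAdjoint h (Φ.selfAdjoint Z)
    · exact IsSelfAdjoint.zero (Op n Λ)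
  · apply isSelfAdjoint_sum
    intro k _
    split_ifs with h
    · exact embed_selfAdjoint _ (hW.selfAdjoint k k.2 s hs)
    · exact IsSelfAdjoint.zero (Op n Λ)

lemma hamiltonianPath_selfAdjoint (hW : IsPerturbationPath K W) {s : ℝ}
    (hs : s ∈ Icc (0 : ℝ) 1) : IsSelfAdjoint (hamiltonianPath Φ hK W s) := by
  rw [← localSum_localTerm_self]
  exact localSum_selfAdjoint (localTerm_selfAdjoint hW hs) Λ

/-- The perturbation changes single-site terms only, so H(s) obeys the Lieb–Robinson bound of Φ
uniformly in s. -/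
lemma norm_localTerm_le (s : ℝ) {Z : Finset Γ} (hZ : 1 < Z.card) :
    ‖localTerm Φ hK W s Z‖ ≤ ‖Φ.term Z‖ := by
  have h1 : ∀ k : K, Z ≠ {(k : Γ)} := fun k h => by
    rw [h, Finset.card_singleton] at hZ
    exact lt_irrefl _ hZ
  have h2 : localTerm Φ hK W s Z = if hZ : Z ⊆ Λ then embed hZ (Φ.term Z) else 0 := by
    simp [localTerm, h1]
  rw [h2]
  split_ifs
  · exact norm_embed_le _ _
  · simp

/-- Increments of the path live on K and see neither Φ nor the rest of Λ. -/
lemma hamiltonianPath_sub (s s' : ℝ) :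
    hamiltonianPath Φ hK W s' - hamiltonianPath Φ hK W s
      = embed hK (perturbation subset_rfl W s' - perturbation subset_rfl W s) := by
  rw [← embedHom_apply, map_sub, embedHom_apply, embedHom_apply, perturbation_embed,
    perturbation_embed, hamiltonianPath, hamiltonianPath]
  abel

lemma norm_perturbation_sub_le (hW : IsPerturbationPath K W) {CW : ℝ}
    (hCW : ∀ s ∈ Icc (0 : ℝ) 1,
      ‖derivWithin (perturbation (Finset.Subset.refl K) W) (Icc 0 1) s‖ ≤ CW)
    {s s' : ℝ} (hs : s ∈ Icc (0 : ℝ) 1) (hs' : s' ∈ Icc (0 : ℝ) 1) :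
    ‖perturbation (Finset.Subset.refl K) W s' - perturbation (Finset.Subset.refl K) W s‖
      ≤ CW * |s' - s| := by
  have hd : DifferentiableOn ℝ (perturbation (Finset.Subset.refl K) W) (Icc 0 1) := by
    unfold perturbation
    exact DifferentiableOn.fun_sum fun k _ =>
      (embedCLM (Finset.singleton_subset_iff.2 k.2)).differentiable.comp_differentiableOn
        ((hW.smooth k k.2).differentiableOn (by simp))
  exact Convex.norm_image_sub_le_of_norm_derivWithin_le hd hCW (convex_Icc 0 1) hs hs'

lemma norm_hamiltonianPath_sub_le (hW : IsPerturbationPath K W) {CW : ℝ}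
    (hCW : ∀ s ∈ Icc (0 : ℝ) 1,
      ‖derivWithin (perturbation (Finset.Subset.refl K) W) (Icc 0 1) s‖ ≤ CW)
    {s s' : ℝ} (hs : s ∈ Icc (0 : ℝ) 1) (hs' : s' ∈ Icc (0 : ℝ) 1) :
    ‖hamiltonianPath Φ hK W s' - hamiltonianPath Φ hK W s‖ ≤ CW * |s' - s| := by
  rw [hamiltonianPath_sub]
  exact (norm_embed_le _ _).trans (norm_perturbation_sub_le hW hCW hs hs')

end LocalTerms

/-! ### Decay functions and fattenings -/

section Geometry

variable {Γ : Type u} {G : SimpleGraph Γ} {F : ℝ → ℝ}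

lemma weight_pos (hF : IsDecayFunction G F) (μ : ℝ) {r : ℝ} (hr : 0 ≤ r) : 0 < weight F μ r :=
  mul_pos (Real.exp_pos _) (hF.pos r hr)

/-- By the triangle inequality the exponential factors only lower the quotient, so C_μ ≤ C_0. -/
lemma convConst_weight_lt_top (hG : G.Connected) (hF : IsDecayFunction G F) {μ : ℝ} (hμ : 0 ≤ μ) :
    convConst G (weight F μ) < ⊤ := by
  refine lt_of_le_of_lt ?_ hF.convolution
  refine iSup_mono fun x => iSup_mono fun y => ENNReal.tsum_le_tsum fun z =>
    ENNReal.ofReal_le_ofReal ?_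
  have hxy := hF.pos (G.dist x y) (by positivity)
  have hxz := hF.pos (G.dist x z) (by positivity)
  have hzy := hF.pos (G.dist z y) (by positivity)
  have htri : (G.dist x y : ℝ) ≤ G.dist x z + G.dist z y := by
    exact_mod_cast hG.dist_triangle
  unfold weight
  rw [div_le_div_iff₀ (by positivity) hxy]
  have h1 : Real.exp (-μ * G.dist x z) * Real.exp (-μ * G.dist z y)
      ≤ Real.exp (-μ * G.dist x y) := by
    rw [← Real.exp_add, Real.exp_le_exp]
    nlinarith
  calc _ = (Real.exp (-μ * G.dist x z) * Real.exp (-μ * G.dist z y)) *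
        (F (G.dist x z) * F (G.dist z y) * F (G.dist x y)) := by ring
    _ ≤ Real.exp (-μ * G.dist x y) * (F (G.dist x z) * F (G.dist z y) * F (G.dist x y)) := by
        gcongr
    _ = _ := by ring

/-- The term x = y = z alone contributes F_μ(0). Positivity matters because the Lieb–Robinson bound
divides by C_μ. -/
lemma convConst_weight_pos (hG : G.Connected) (hF : IsDecayFunction G F) {μ : ℝ} (hμ : 0 ≤ μ) :
    0 < (convConst G (weight F μ)).toReal := by
  refine ENNReal.toReal_pos ?_ (convConst_weight_lt_top hG hF hμ).ne
  obtain ⟨x⟩ := hG.nonempty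
  have h0 := weight_pos hF μ (r := G.dist x x) (by positivity)
  have h1 : ENNReal.ofReal (weight F μ (G.dist x x) * weight F μ (G.dist x x)
      / weight F μ (G.dist x x)) ≤ convConst G (weight F μ) :=
    (ENNReal.le_tsum x).trans (le_iSup₂ (f := fun x y => ∑' z : Γ, ENNReal.ofReal
      (weight F μ (G.dist x z) * weight F μ (G.dist z y) / weight F μ (G.dist x y))) x x)
  refine (lt_of_lt_of_le ?_ h1).ne'
  rw [ENNReal.ofReal_pos]
  positivity

lemma sum_weight_mul_weight_le (hG : G.Connected) (hF : IsDecayFunction G F) {μ : ℝ} (hμ : 0 ≤ μ)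
    (S : Finset Γ) (x y : Γ) :
    ∑ z ∈ S, weight F μ (G.dist x z) * weight F μ (G.dist z y)
      ≤ (convConst G (weight F μ)).toReal * weight F μ (G.dist x y) := by
  have hp : ∀ a b : Γ, 0 < weight F μ (G.dist a b) := fun a b => weight_pos hF μ (by positivity)
  rw [← div_le_iff₀ (hp x y), Finset.sum_div,
    ← ENNReal.ofReal_le_iff_le_toReal (convConst_weight_lt_top hG hF hμ).ne,
    ENNReal.ofReal_sum_of_nonneg fun z _ =>
      (div_pos (mul_pos (hp x z) (hp z y)) (hp x y)).le]
  exact (ENNReal.sum_le_tsum S).trans (le_iSup₂ (f := fun x y => ∑' z : Γ, ENNReal.ofReal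
      (weight F μ (G.dist x z) * weight F μ (G.dist z y) / weight F μ (G.dist x y))) x y)

lemma sum_decay_le (hF : IsDecayFunction G F) (S : Finset Γ) (x : Γ) :
    ∑ y ∈ S, F (G.dist x y) ≤ (sumNorm G F).toReal := by
  rw [← ENNReal.ofReal_le_iff_le_toReal hF.summable.ne,
    ENNReal.ofReal_sum_of_nonneg fun z _ => (hF.pos _ (by positivity)).le]
  exact (ENNReal.sum_le_tsum S).trans
    (le_iSup (f := fun x => ∑' y : Γ, ENNReal.ofReal (F (G.dist x y))) x)

variable [DecidableEq Γ]

/-- Gives finiteness of the restricted norm; for an infinite value the `toReal` in `velocity` would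
be 0. -/
lemma norm'_le_norm {n : Γ → ℕ} (Φ : Interaction n) (F : ℝ → ℝ) : Φ.norm' G F ≤ Φ.norm G F := by
  refine iSup_mono fun x => iSup_mono fun y => ?_
  let ι : {X : Finset Γ // (x ∈ X ∧ y ∈ X) ∧ 1 < X.card} → {X : Finset Γ // x ∈ X ∧ y ∈ X} :=
    fun X => ⟨X.1, X.2.1⟩
  exact ENNReal.tsum_comp_le_tsum_of_injective (f := ι)
    (fun X Y h => Subtype.ext (congrArg (fun Z => Z.1) h))
    (fun X => ENNReal.ofReal (‖Φ.term X.1‖ / F (G.dist x y)))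

lemma sum_norm_term_le {n : Γ → ℕ} {Φ : Interaction n} (hF : IsDecayFunction G F) {μ : ℝ}
    (hΦ : Φ.norm' G (weight F μ) < ⊤) (Λ : Finset Γ) (x y : Γ) :
    ∑ Z ∈ Λ.powerset with (x ∈ Z ∧ y ∈ Z) ∧ 1 < Z.card, ‖Φ.term Z‖
      ≤ (Φ.norm' G (weight F μ)).toReal * weight F μ (G.dist x y) := by
  have hp : 0 < weight F μ (G.dist x y) := weight_pos hF μ (by positivity)
  rw [← div_le_iff₀ hp, Finset.sum_div, ← ENNReal.ofReal_le_iff_le_toReal hΦ.ne,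
    ENNReal.ofReal_sum_of_nonneg fun z _ => div_nonneg (norm_nonneg _) hp.le]
  refine le_trans ?_ (le_iSup₂ (f := fun x y =>
    ∑' X : {X : Finset Γ // (x ∈ X ∧ y ∈ X) ∧ 1 < X.card},
      ENNReal.ofReal (‖Φ.term X.1‖ / weight F μ (G.dist x y))) x y)
  rw [← Finset.sum_subtype_of_mem (p := fun X : Finset Γ => (x ∈ X ∧ y ∈ X) ∧ 1 < X.card)
    (fun Z => ENNReal.ofReal (‖Φ.term Z‖ / weight F μ (G.dist x y)))
    fun Z hZ => (Finset.mem_filter.1 hZ).2]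
  exact ENNReal.sum_le_tsum _

lemma mem_fattening {Λ K : Finset Γ} {l : ℝ} {x : Γ} :
    x ∈ fattening G Λ K l ↔ x ∈ Λ ∧ ∃ k ∈ K, (G.dist k x : ℝ) ≤ l := by
  simp [fattening]

lemma subset_fattening {Λ K : Finset Γ} (hK : K ⊆ Λ) {l : ℝ} (hl : 0 < l) :
    K ⊆ fattening G Λ K l := fun k hk =>
  mem_fattening.2 ⟨hK hk, k, hk, by simpa using hl.le⟩

/-- The total weight between `K` and the complement of its `l`-fattening. -/
lemma sum_weight_fattening_compl_le (hF : IsDecayFunction G F) {μ : ℝ} (hμ : 0 ≤ μ)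
    (Λ K : Finset Γ) (l : ℝ) :
    ∑ x ∈ K, ∑ y ∈ Λ \ fattening G Λ K l, weight F μ (G.dist x y)
      ≤ K.card * (Real.exp (-(μ * l)) * (sumNorm G F).toReal) := by
  rw [← nsmul_eq_mul]
  refine Finset.sum_le_card_nsmul _ _ _ fun x hx => ?_
  refine le_trans ?_ (mul_le_mul_of_nonneg_left (sum_decay_le hF (Λ \ fattening G Λ K l) x)
    (Real.exp_pos _).le)
  rw [Finset.mul_sum]
  refine Finset.sum_le_sum fun y hy => ?_
  rw [Finset.mem_sdiff, mem_fattening] at hy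
  have h1 : l < G.dist x y := by
    by_contra h
    exact hy.2 ⟨hy.1, x, hx, not_lt.1 h⟩
  refine mul_le_mul_of_nonneg_right (Real.exp_le_exp.2 ?_) (hF.pos _ (by positivity)).le
  nlinarith

end Geometry

/-! ### Local transport along the whole path -/

section Approximation

variable {Γ : Type u} [DecidableEq Γ] {G : SimpleGraph Γ} {F : ℝ → ℝ} {n : Γ → ℕ}
  {Φ : Interaction n} {K Λ : Finset Γ} {hK : K ⊆ Λ} {W : (k : Γ) → ℝ → Op n {k}}

/-- The Lieb--Robinson estimate for the dynamics of `H(s)` in `Λ` and in the fattening of `K`,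
applied to an observable with support in `K`. -/
lemma norm_heis_hamiltonianPath_sub_le (hG : G.Connected) (hF : IsDecayFunction G F) {μ : ℝ}
    (hμ : 0 < μ) (hΦ : Φ.norm G (weight F μ) < ⊤) (hW : IsPerturbationPath K W) {l : ℝ}
    (hl : 0 < l) {s : ℝ} (hs : s ∈ Icc (0 : ℝ) 1) {V : Op n Λ} (hV : V ∈ supportAlgebra hK)
    {r T : ℝ} (hr : |r| ≤ T) :
    ‖heis (hamiltonianPath Φ hK W s) V r - heis (embed (fattening_subset G Λ K l)
        (hamiltonianPath Φ (subset_fattening (G := G) hK hl) W s)) V r‖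
      ≤ ‖V‖ * (Real.exp (μ * velocity G F μ Φ * T) / (convConst G (weight F μ)).toReal *
        (K.card * (Real.exp (-(μ * l)) * (sumNorm G F).toReal))) := by
  set C := (convConst G (weight F μ)).toReal with hC_def
  have hC : 0 < C := convConst_weight_pos hG hF hμ.le
  have hΦ' : Φ.norm' G (weight F μ) < ⊤ := (norm'_le_norm Φ _).trans_lt hΦ
  set J := (Φ.norm' G (weight F μ)).toReal with hJ_def
  have hJ : 0 ≤ J := ENNReal.toReal_nonneg
  have hv : μ * velocity G F μ Φ = 2 * J * C := by
    rw [velocity, ← hJ_def, ← hC_def]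
    field_simp
  have h := norm_heis_localSum_sub_le_abs (h := localTerm Φ hK W s)
    (f := fun x y => weight F μ (G.dist x y)) (J := J) (C := C) (X := K) (A := V)
    (localTerm_selfAdjoint hW hs) (fattening_subset G Λ K l)
    (fun Z hZ Z' hZ' hd => commute_of_mem_supportAlgebra hd (localTerm_mem_supportAlgebra s hZ)
      (localTerm_mem_supportAlgebra s hZ'))
    (fun x y => (weight_pos hF μ (by positivity)).le) hJ hC
    (fun x _ y _ => sum_weight_mul_weight_le hG hF hμ.le Λ x y)
    (fun x _ z _ => (Finset.sum_le_sum fun Z hZ =>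
      norm_localTerm_le s (Finset.mem_filter.1 hZ).2.2).trans (sum_norm_term_le hF hΦ' Λ x z))
    (subset_fattening hK hl)
    (fun Z hZ hd => commute_of_mem_supportAlgebra hd.symm hV (localTerm_mem_supportAlgebra s hZ)) r
  rw [localSum_localTerm_self, localSum_localTerm (subset_fattening hK hl)] at h
  refine h.trans (mul_le_mul_of_nonneg_left ?_ (norm_nonneg V))
  have h1 : Real.exp (2 * J * C * |r|) - 1 ≤ Real.exp (μ * velocity G F μ Φ * T) := by
    rw [hv]
    have : Real.exp (2 * J * C * |r|) ≤ Real.exp (2 * J * C * T) := by gcongr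
    linarith
  refine mul_le_mul (div_le_div_of_nonneg_right h1 hC.le)
    (sum_weight_fattening_compl_le hF hμ.le Λ K l) ?_ (by positivity)
  exact Finset.sum_nonneg fun x _ => Finset.sum_nonneg fun y _ =>
    (weight_pos hF μ (by positivity)).le

/-- The eigenvectors at `s = 1` are approximated by the action of an operator with support in the
fattening of `K` on the sector at `s = 0`. -/
lemma exists_local_transport (hG : G.Connected) (hF : IsDecayFunction G F) {μ : ℝ}
    (hμ : 0 < μ) (hΦ : Φ.norm G (weight F μ) < ⊤) (hW : IsPerturbationPath K W) {CW : ℝ}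
    (hCW : ∀ s ∈ Icc (0 : ℝ) 1,
      ‖derivWithin (perturbation (Finset.Subset.refl K) W) (Icc 0 1) s‖ ≤ CW)
    {σin σout : ℝ → Set ℝ} {g L : ℝ} {D : ℕ} (hg : 0 < g)
    (hgap : IsGappedSector (hamiltonianPath Φ hK W) σin σout g L D) {ψ : ℝ → Fin D → Hilb n Λ}
    (hψ : ∀ s ∈ Icc (0 : ℝ) 1, IsEigenbasisIn (hamiltonianPath Φ hK W s) (σin s) (ψ s))
    {l : ℝ} (hl : 0 < l) {g' : ℝ} (hg'0 : 0 < g') (hg' : g' < g) {T : ℝ} (hT : 0 < T) {η : ℝ}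
    (hη : 0 < η) :
    ∃ B : Op n (fattening G Λ K l),
      (∀ x, ‖embed (fattening_subset G Λ K l) B x‖ ≤ 2 * ‖x‖) ∧
      ∀ φ' ∈ Submodule.span ℂ (range (ψ 1)), ∃ φ ∈ Submodule.span ℂ (range (ψ 0)),
        ‖φ‖ ≤ 2 * ‖φ'‖ ∧ ‖φ' - embed (fattening_subset G Λ K l) B φ‖ ≤
          (6 * η + 4 * (CW * (D * (3 * Real.exp (-(g' * T / 2)) / g') +
            T * (Real.exp (μ * velocity G F μ Φ * T) / (convConst G (weight F μ)).toReal *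
              (K.card * (Real.exp (-(μ * l)) * (sumNorm G F).toReal)))))) * ‖φ'‖ := by
  set hΩ := fattening_subset G Λ K l
  have hKΩ : K ⊆ fattening G Λ K l := subset_fattening hK hl
  set H := hamiltonianPath Φ hK W with hH_def
  have hsa : ∀ s ∈ Icc (0 : ℝ) 1, IsSelfAdjoint (H s) := fun s hs =>
    hamiltonianPath_selfAdjoint hW hs
  have hCW0 : 0 ≤ CW := (norm_nonneg _).trans (hCW 0 (by simp))
  have hlip : ∀ s ∈ Icc (0 : ℝ) 1, ∀ s' ∈ Icc (0 : ℝ) 1, ‖H s' - H s‖ ≤ CW * |s' - s| :=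
    fun s hs s' hs' => norm_hamiltonianPath_sub_le hW hCW hs hs'
  have hcont : ContinuousOn H (Icc 0 1) := by
    have : LipschitzOnWith CW.toNNReal H (Icc 0 1) := by
      refine LipschitzOnWith.of_dist_le_mul fun s' hs' s hs => ?_
      rw [dist_eq_norm, Real.dist_eq, Real.coe_toNNReal _ hCW0]
      exact hlip s hs s' hs'
    exact this.continuousOn
  obtain ⟨δ, hδ, hsplit⟩ := hgap.exists_uniform_split hg hcont hsa hψ hg'
  set b₀ := Real.exp (μ * velocity G F μ Φ * T) / (convConst G (weight F μ)).toReal *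
    (K.card * (Real.exp (-(μ * l)) * (sumNorm G F).toReal)) with hb₀_def
  have hb₀ : 0 ≤ b₀ := by positivity
  set ε := 3 * Real.exp (-(g' * T / 2)) / g' with hε_def
  have hε : 0 ≤ ε := by positivity
  -- Steps must be shorter than δ, and the accumulated second-order error τ = m y² must be at most
  -- η. The bound τ ≤ 1/4 gives q^(2m) = e^{2τ} ≤ 2.
  obtain ⟨m, hm⟩ := exists_nat_gt (max (1 / δ) (T ^ 2 * CW ^ 2 / min (1 / 4) η))
  have hN1 : 1 / δ < m := (le_max_left _ _).trans_lt hm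
  have hN2 : T ^ 2 * CW ^ 2 / min (1 / 4) η < m := (le_max_right _ _).trans_lt hm
  have hN0 : (0 : ℝ) < m := (by positivity : (0 : ℝ) < 1 / δ).trans hN1
  have hδN : 1 / (m : ℝ) < δ := by rw [one_div_lt hN0 hδ]; exact hN1
  set τ := T ^ 2 * CW ^ 2 / m with hτ_def
  have hτ0 : 0 ≤ τ := by positivity
  have hτ : τ ≤ min (1 / 4) η := by
    rw [div_lt_iff₀ (by positivity)] at hN2
    rw [hτ_def, div_le_iff₀ hN0]
    linarith
  have hτ1 : τ ≤ 1 / 4 := hτ.trans (min_le_left _ _)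
  have hτ2 : τ ≤ η := hτ.trans (min_le_right _ _)
  set w := CW / m with hw_def
  have hw : 0 ≤ w := by positivity
  set y := T * w with hy_def
  have hmy : m * y ^ 2 = τ := by rw [hy_def, hw_def, hτ_def]; field_simp
  set q := Real.exp (y ^ 2) with hq_def
  have hq : 1 ≤ q := Real.one_le_exp (sq_nonneg y)
  have hexp : ∀ z : ℝ, z ≤ 1 / 2 → Real.exp z ≤ 2 := by
    intro z hz
    rw [← Real.le_log_iff_exp_le two_pos]
    linarith [Real.log_two_gt_d9]
  have hqm : q ^ m ≤ 2 := by
    rw [hq_def, ← Real.exp_nat_mul, hmy]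
    exact hexp _ (by linarith)
  have hq2m : q ^ (2 * m) ≤ 2 := by
    rw [hq_def, ← Real.exp_nat_mul]
    push_cast
    rw [mul_assoc, hmy]
    exact hexp _ (by linarith)
  have hq1 : q ≤ 2 := by
    refine le_trans ?_ hqm
    exact le_self_pow₀ hq (by rintro rfl; simp at hN0)
  set e := y ^ 2 + q * (D * (ε * w) + T * (T * w ^ 2 + w * b₀)) with he_def
  have he : 0 ≤ e := by positivity
  set t : ℕ → ℝ := fun k => k / m with ht_def
  have htI : ∀ k ≤ m, t k ∈ Icc (0 : ℝ) 1 := fun k hk =>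
    ⟨by positivity, div_le_one_of_le₀ (by exact_mod_cast hk) hN0.le⟩
  have htd : ∀ k, t (k + 1) - t k = 1 / m := fun k => by rw [ht_def]; push_cast; ring
  set V : ℕ → Op n K := fun k => perturbation subset_rfl W (t (k + 1)) -
    perturbation subset_rfl W (t k) with hV_def
  have hHV : ∀ k, H (t (k + 1)) - H (t k) = embed hK (V k) := fun k => hamiltonianPath_sub _ _
  set Y : ℕ → Op n (fattening G Λ K l) := fun k => generator (g' / (2 * T)) T
    (hamiltonianPath Φ hKΩ W (t k)) (embed hKΩ (V k)) with hY_def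
  have hα : 0 < g' / (2 * T) := by positivity
  have hYe : ∀ k, embed hΩ (Y k) = generator (g' / (2 * T)) T
      (embed hΩ (hamiltonianPath Φ hKΩ W (t k))) (H (t (k + 1)) - H (t k)) := by
    intro k
    rw [← embedHom_apply, hY_def, map_generator, embedHom_apply, embedHom_apply, embed_embed, hHV]
  have hVn : ∀ k < m, ‖H (t (k + 1)) - H (t k)‖ ≤ w := by
    intro k hk
    refine (hlip _ (htI k hk.le) _ (htI (k + 1) hk)).trans (le_of_eq ?_)
    rw [htd, abs_of_pos (by positivity), hw_def]
    ring
  have hHe : ∀ k ≤ m, IsSelfAdjoint (embed hΩ (hamiltonianPath Φ hKΩ W (t k))) := fun k hk =>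
    embed_selfAdjoint hΩ (hamiltonianPath_selfAdjoint hW (htI k hk))
  have hYs : ∀ k < m, star (embed hΩ (Y k)) = -embed hΩ (Y k) := by
    intro k hk
    rw [hYe]
    exact star_generator (hHe k hk.le) ((hsa _ (htI (k + 1) hk)).sub (hsa _ (htI k hk.le)))
  have hYn : ∀ k < m, ‖embed hΩ (Y k)‖ ≤ y := by
    intro k hk
    rw [hYe]
    exact (norm_generator_le hα hT.le (hHe k hk.le) _).trans
      (mul_le_mul_of_nonneg_left (hVn k hk) hT.le)
  have hcmp : ∀ k < m, ‖mixedGenerator (g' / (2 * T)) T (H (t k)) (H (t (k + 1)))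
      - embed hΩ (Y k)‖ ≤ T * (T * w ^ 2 + w * b₀) := by
    intro k hk
    rw [hYe]
    refine (norm_mixedGenerator_sub_generator_le hα hT.le (hsa _ (htI k hk.le))
      (hsa _ (htI (k + 1) hk)) (b := w * b₀) (by positivity) fun r hr => ?_).trans ?_
    · refine (norm_heis_hamiltonianPath_sub_le hG hF hμ hΦ hW hl (htI k hk.le) ?_ hr).trans
        (mul_le_mul_of_nonneg_right (hVn k hk) hb₀)
      rw [hHV]
      exact embed_mem_supportAlgebra hK _
    · refine mul_le_mul_of_nonneg_left (add_le_add_left ?_ _) hT.le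
      exact mul_le_mul_of_nonneg_left (pow_le_pow_left₀ (norm_nonneg _) (hVn k hk) 2) hT.le
  obtain ⟨B, hB, hBM⟩ := exists_transport hΩ hq he
    (fun k => Submodule.span ℂ (range (ψ (t k)))) Y (N := m)
    (fun k hk x => norm_add_skew_le (hYs k hk) (hYn k hk) x)
    (fun k hk φ' hφ' => by
      obtain ⟨ev', hev', hsp⟩ := hsplit _ (htI k hk.le) _ (htI (k + 1) hk)
        (by rw [abs_sub_comm, htd, abs_of_pos (by positivity)]; exact hδN)
      obtain ⟨φ, hφ, h1, h2⟩ := exists_transport_step (hsa _ (htI k hk.le)) hg'0 hT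
        (hψ _ (htI (k + 1) hk)).1 hev' hsp (hYs k hk) (hYn k hk) (hcmp k hk) hφ'
      refine ⟨φ, hφ, h1, h2.trans (mul_le_mul_of_nonneg_right ?_ (norm_nonneg _))⟩
      rw [he_def]
      refine add_le_add_right (mul_le_mul_of_nonneg_left (add_le_add_left
        (mul_le_mul_of_nonneg_left ?_ (Nat.cast_nonneg D)) _) (zero_le_one.trans hq)) _
      exact mul_le_mul_of_nonneg_left (hVn k hk) hε)
  have ht0 : t 0 = 0 := by simp [ht_def]
  have htm : t m = 1 := by simp [ht_def, hN0.ne']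
  simp only [ht0, htm] at hBM
  have htotal : q ^ (2 * m) * (m * e) ≤ 6 * η + 4 * (CW * (D * ε + T * b₀)) := by
    -- Since m w = C_W, the first-order errors add up independently of m.
    have h1 : m * e = τ + q * (CW * (D * ε + T * b₀) + τ) := by
      rw [he_def, mul_add, hmy, ← hmy, hy_def, hw_def]
      field_simp
      ring
    have h2 : 0 ≤ CW * (D * ε + T * b₀) := by positivity
    have h3 : m * e ≤ η + 2 * (CW * (D * ε + T * b₀) + η) := by
      rw [h1]
      have := mul_le_mul hq1 (add_le_add_right hτ2 (CW * (D * ε + T * b₀))) (by positivity) two_pos.le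
      linarith
    have h4 : 0 ≤ m * e := by positivity
    calc q ^ (2 * m) * (m * e) ≤ 2 * (η + 2 * (CW * (D * ε + T * b₀) + η)) :=
          mul_le_mul hq2m h3 h4 two_pos.le
      _ = _ := by ring
  refine ⟨B, fun x => (hB x).trans (mul_le_mul_of_nonneg_right hqm (norm_nonneg _)),
    fun φ' hφ' => ?_⟩
  obtain ⟨φ, hφ, h1, h2⟩ := hBM φ' hφ'
  exact ⟨φ, hφ, h1.trans (mul_le_mul_of_nonneg_right hqm (norm_nonneg _)),
    h2.trans (mul_le_mul_of_nonneg_right htotal (norm_nonneg _))⟩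

end Approximation

/-- Below the inverse length scale there is room for a smaller gap. -/
lemma exists_smaller_gap {μ v g μ' : ℝ} (hμ : 0 < μ) (hv : 0 ≤ v) (hg : 0 < g)
    (hμ' : μ' < 1 / xi μ v g) :
    ∃ g', 0 < g' ∧ g' < g ∧ μ' < μ * g' / (g' + 2 * μ * v) := by
  have h1 : 1 / xi μ v g = μ * g / (g + 2 * μ * v) := by
    rw [xi]
    have : 0 < g + 2 * μ * v := by positivity
    field_simp
  rw [h1] at hμ'
  -- At x = g this function equals 1/ξ, so a strict inequality there persists slightly to the left.
  have hc : ContinuousAt (fun x => μ * x / (x + 2 * μ * v)) g :=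
    ContinuousAt.div (by fun_prop) (by fun_prop) (by positivity)
  have h2 : ∀ᶠ x in nhdsWithin g (Iio g), μ' < μ * x / (x + 2 * μ * v) :=
    (hc.eventually_const_lt hμ').filter_mono nhdsWithin_le_nhds
  obtain ⟨x, hx, hx'⟩ := (h2.and (Ioo_mem_nhdsLT hg)).exists
  exact ⟨x, hx'.1, hx'.2, hx⟩

end QuantumSpin

end

/-! ### Choice of the time cut-off and of the constant -/

open QuantumSpin in
theorem theorem3p2 (μ N Cμ v g CW L μ' : ℝ) (κ D : ℕ) (hμ : 0 < μ) (hg : 0 < g)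
    (hμ' : μ' < 1 / xi μ v g) :
    ∃ C : ℝ, 0 ≤ C ∧
      ∀ (Γ : Type u) [DecidableEq Γ] (G : SimpleGraph Γ) (_ : G.Connected)
        (F : ℝ → ℝ) (_ : IsDecayFunction G F)
        (n : Γ → ℕ) (Φ : Interaction n) (_ : Φ.norm G (weight F μ) < ⊤)
        (K : Finset Γ) (W : (k : Γ) → ℝ → Op n {k}) (_ : IsPerturbationPath K W)
        (_ : (sumNorm G F).toReal = N) (_ : (convConst G (weight F μ)).toReal = Cμ)
        (_ : velocity G F μ Φ = v) (_ : K.card = κ)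
        (_ : ∀ s ∈ Icc (0 : ℝ) 1,
          ‖derivWithin (perturbation (Finset.Subset.refl K) W) (Icc 0 1) s‖ ≤ CW)
        (Λ : Finset Γ) (_ : IsVolume G Λ) (hK : K ⊆ Λ)
        (σin σout : ℝ → Set ℝ)
        (_ : IsGappedSector (hamiltonianPath Φ hK W) σin σout g L D)
        (ψ : ℝ → Fin D → Hilb n Λ)
        (_ : ∀ s ∈ Icc (0 : ℝ) 1, IsEigenbasisIn (hamiltonianPath Φ hK W s) (σin s) (ψ s))
        (l : ℝ) (_ : 0 < l) (i : Fin D),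
        ∃ A : Fin D → Op n Λ,
          (∀ j, SupportedIn (fattening_subset G Λ K l) (A j)) ∧
          (∀ j, ‖A j‖ ≤ C) ∧
          ‖ψ 1 i - ∑ j, A j (ψ 0 j)‖ ≤ C * Real.exp (-μ' * l) := by
  -- The constant is fixed before the system, so the signs of the parameters are not yet known. With
  -- wrong signs no system has these data and C = 0 works vacuously.
  by_cases hpos : 0 ≤ v ∧ 0 < Cμ ∧ 0 ≤ N ∧ 0 ≤ CW
  swap
  · refine ⟨0, le_rfl, ?_⟩
    intro Γ _ G hG F hF n Φ hΦ K W hW hN hCμ hv hκ hCW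
    refine absurd ⟨?_, ?_, ?_, ?_⟩ hpos
    · rw [← hv, velocity]
      positivity
    · rw [← hCμ]
      exact convConst_weight_pos hG hF hμ.le
    · rw [← hN]
      exact ENNReal.toReal_nonneg
    · exact (norm_nonneg _).trans (hCW 0 (by simp))
  obtain ⟨hv0, hCμ0, hN0, hCW0⟩ := hpos
  obtain ⟨g', hg'0, hg', hrate⟩ := exists_smaller_gap hμ hv0 hg hμ'
  set R := μ * g' / (g' + 2 * μ * v) with hR_def
  have hden : 0 < g' + 2 * μ * v := by positivity
  -- With T = c l the filter exponent g'T/2 and the Lieb–Robinson exponent μ(l - vT) both equal R l.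
  set c := 2 * μ / (g' + 2 * μ * v) with hc_def
  have hc : 0 < c := by positivity
  have hgapR : 0 < R - μ' := by linarith
  set P := κ * N / Cμ with hP_def
  have hP : 0 ≤ P := by positivity
  -- The summand 10 covers both the 6 from the discretisation and the operator bound 2 · 2; 6 would
  -- suffice. The denominator R - μ' comes from absorbing the factor T = c l.
  refine ⟨10 + 4 * CW * (3 * D / g' + c / (R - μ') * P), by positivity, ?_⟩
  intro Γ _ G hG F hF n Φ hΦ K W hW hN hCμ hv hκ hCW Λ hΛ hK σin σout hgap ψ hψ l hl i
  have h0 : (0 : ℝ) ∈ Icc (0 : ℝ) 1 := by simp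
  have h1 : (1 : ℝ) ∈ Icc (0 : ℝ) 1 := by simp
  -- The discretisation error η is set to e^{-Rl}, the size of the other two errors.
  obtain ⟨B, hB, hBM⟩ := exists_local_transport hG hF hμ hΦ hW hCW hg hgap hψ hl hg'0 hg'
    (T := c * l) (by positivity) (Real.exp_pos (-(R * l)))
  obtain ⟨φ, hφ, hφn, hφd⟩ := hBM (ψ 1 i) (Submodule.subset_span (mem_range_self i))
  rw [(hψ 1 h1).1.1 i, mul_one] at hφn hφd
  set hΩ := fattening_subset G Λ K l
  obtain ⟨a, ha⟩ := (Submodule.mem_span_range_iff_exists_fun ℂ).1 hφ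
  have han : ∀ j, ‖a j‖ ≤ 2 := by
    intro j
    have h2 : inner ℂ (ψ 0 j) φ = a j := by rw [← ha, (hψ 0 h0).1.inner_right_fintype]
    rw [← h2]
    have h3 := norm_inner_le_norm (𝕜 := ℂ) (ψ 0 j) φ
    rw [(hψ 0 h0).1.1 j, one_mul] at h3
    exact h3.trans hφn
  have hBn : ‖embed hΩ B‖ ≤ 2 := ContinuousLinearMap.opNorm_le_bound _ two_pos.le hB
  -- All operators are multiples of one transport B; the coefficients are those of φ in the basis
  -- ψ_j(0).
  refine ⟨fun j => a j • embed hΩ B, fun j => ⟨a j • B, embed_smul hΩ (a j) B⟩, fun j => ?_, ?_⟩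
  · rw [norm_smul]
    have h2 : ‖a j‖ * ‖embed hΩ B‖ ≤ 2 * 2 :=
      mul_le_mul (han j) hBn (norm_nonneg _) two_pos.le
    have h3 : 0 ≤ 4 * CW * (3 * D / g' + c / (R - μ') * P) := by positivity
    linarith
  · have hsum : ∑ j, (a j • embed hΩ B) (ψ 0 j) = embed hΩ B φ := by
      rw [← ha, map_sum]
      exact Finset.sum_congr rfl fun j _ => by rw [smul_apply, map_smul]
    rw [hsum]
    refine hφd.trans ?_
    rw [hv, hCμ, hκ, hN]
    have e1 : -(g' * (c * l) / 2) = -(R * l) := by rw [hc_def, hR_def]; field_simp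
    have e2 : Real.exp (μ * v * (c * l)) * Real.exp (-(μ * l)) = Real.exp (-(R * l)) := by
      rw [← Real.exp_add, hc_def, hR_def]
      congr 1
      field_simp
      ring
    set η := Real.exp (-(R * l)) with hη_def
    have e3 : Real.exp (μ * v * (c * l)) / Cμ * (κ * (Real.exp (-(μ * l)) * N)) = η * P := by
      rw [← e2, hP_def]; ring
    rw [e1, e3]
    have hη : η = Real.exp (-((R - μ') * l)) * Real.exp (-μ' * l) := by
      rw [hη_def, ← Real.exp_add]
      congr 1
      ring
    set χ := Real.exp (-μ' * l) with hχ_def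
    have hχ : 0 < χ := Real.exp_pos _
    have hη1 : η ≤ χ := by
      rw [hη]
      have : Real.exp (-((R - μ') * l)) ≤ 1 := Real.exp_le_one_iff.2 (by nlinarith)
      nlinarith
    have hη2 : l * η ≤ χ / (R - μ') := by
      rw [hη, le_div_iff₀ hgapR]
      have h2 := Real.add_one_le_exp ((R - μ') * l)
      have h3 : (R - μ') * l * Real.exp (-((R - μ') * l)) ≤ 1 := by
        rw [Real.exp_neg, ← div_eq_mul_inv, div_le_one (Real.exp_pos _)]
        linarith
      nlinarith
    calc 6 * η + 4 * (CW * (D * (3 * η / g') + c * l * (η * P)))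
        = 6 * η + 4 * CW * (3 * D / g' * η + c * P * (l * η)) := by ring
      _ ≤ 6 * χ + 4 * CW * (3 * D / g' * χ + c * P * (χ / (R - μ'))) := by gcongr
      _ ≤ 10 * χ + 4 * CW * (3 * D / g' * χ + c * P * (χ / (R - μ'))) := by linarith
      _ = _ := by ring
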